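/- Let $H$ be a complex Hilbert space (inner products linear in the second variable, $|x\rangle\langle y|(z)=\langle y,z\rangle x$). Let $L$, with domain $D(L)$, be the ($\sigma$-weak) generator of a quantum Markov semigroup $(T_t)_{t\ge 0}$ on $\mathcal B(H)$, i.e. of a one-parameter semigroup of $\sigma$-weakly continuous, completely positive, unital linear maps on $\mathcal B(H)$ with $T_0=\mathrm{id}$ and $\sigma$-weakly continuous orbits $t\mapsto T_t(A)$. Let $\mathcal A$ be the domain algebra of $L$, the largest $*$-subalgebra of $\mathcal B(H)$ contained in $D(L)$. Let $T\in D(L)$ be a nonzero positive finite rank operator and let $h$ be an associate vector for $T$; that is, there is a decomposition $T=\sum_{s=1}^m t'_s|k'_s\rangle\langle k'_s|$ with $(k'_s)$ orthonormal and $t'_s>0$ such that, with $t=\sum_s t'_s$ and $k_s=\sqrt t\,k'_s$, one has $h=\sum_s\|k_s\|^{-2}k_s$. Assume that $|Th\rangle\langle Th|\in D(L)$, put $U=\{x\in H: |x\rangle\langle Th|\in\mathcal A\}$, and assume that $U$ is norm dense in $H$ and that there is $C>0$ with $\|L(|x\rangle\langle Th|)h\|\le C\|x\|$ for all $x\in U$.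 By a minimal Stinespring-type dilation we mean a Hilbert space $K$, bounded operators $G:H\to H$ and $V:H\to K$, and a norm-continuous unital $*$-representation $\pi:\mathcal A\to\mathcal B(K)$, such that $$L(A)=V^*\pi(A)V+GA+AG^*\qquad(A\in\mathcal A)$$ and $\{\pi(A)Vx: A\in\mathcal A,\ x\in U\}$ is total in $K$. Then a minimal Stinespring-type dilation exists, and it can be chosen with $Gx=L(|x\rangle\langle Th|)h-\tfrac12\langle h,L(T)h\rangle x$ for all $x\in U$. Moreover, for every minimal Stinespring-type dilation, the representation $\pi$ is ($\sigma$-weak, $\sigma$-weak)-closable: whenever $(A_\lambda)$ is a net in $\mathcal A$ with $A_\lambda\to0$ $\sigma$-weakly and $\pi(A_\lambda)\to B$ $\sigma$-weakly for some $B\in\mathcal B(K)$, then $B=0$. -/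

import Mathlib

open Filter Topology
open scoped NNReal InnerProductSpace CStarAlgebra

universe u v

noncomputable section

/-- The σ-weak topology on the bounded operators of a Hilbert space: the coarsest topology that
makes continuous all functionals `A ↦ ∑ₙ ⟪xₙ, A yₙ⟫` with `∑ₙ ‖xₙ‖² < ∞` and `∑ₙ ‖yₙ‖² < ∞`. These
functionals are exactly those given by the trace class operators `∑ₙ |yₙ⟩⟨xₙ|`. -/
@[reducible]
def sigmaWeak (H : Type*) [NormedAddCommGroup H] [InnerProductSpace ℂ H] :
    TopologicalSpace (H →L[ℂ] H) :=
  ⨅ (x : ℕ → H) (y : ℕ → H) (_ : Summable fun n => ‖x n‖ ^ 2) (_ : Summable fun n => ‖y n‖ ^ 2),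
    TopologicalSpace.induced (fun A : H →L[ℂ] H => ∑' n, ⟪x n, A (y n)⟫_ℂ) inferInstance

/-- σ-weak convergence of an operator-valued function `f` to `B` along a filter. -/
def SigmaWeakTendsto {ι H : Type*} [NormedAddCommGroup H] [InnerProductSpace ℂ H]
    (f : ι → H →L[ℂ] H) (l : Filter ι) (B : H →L[ℂ] H) : Prop :=
  Tendsto f l (@nhds (H →L[ℂ] H) (sigmaWeak H) B)

/-- A quantum Markov semigroup on `B(H)`: a one-parameter semigroup of σ-weakly continuous,
completely positive, unital linear maps with σ-weakly continuous orbits. -/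
structure QuantumMarkovSemigroup (H : Type u) [NormedAddCommGroup H] [InnerProductSpace ℂ H]
    [CompleteSpace H] where
  toFun : ℝ≥0 → ((H →L[ℂ] H) →CP (H →L[ℂ] H))
  sigmaWeak_continuous : ∀ t, Continuous[sigmaWeak H, sigmaWeak H] (toFun t)
  map_zero : ∀ A, toFun 0 A = A
  map_add : ∀ t s A, toFun (t + s) A = toFun t (toFun s A)
  orbit_continuous : ∀ A, Continuous[inferInstance, sigmaWeak H] fun t => toFun t A
  map_one : ∀ t, toFun t 1 = 1

namespace QuantumMarkovSemigroup

variable {H : Type u} [NormedAddCommGroup H] [InnerProductSpace ℂ H] [CompleteSpace H]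

/-- `B` is the σ-weak limit of `t⁻¹ (T_t A - A)` as `t → 0`, `t > 0`. -/
def IsDerivAtZero (S : QuantumMarkovSemigroup H) (A B : H →L[ℂ] H) : Prop :=
  SigmaWeakTendsto (fun t : ℝ≥0 => ((t : ℝ) : ℂ)⁻¹ • (S.toFun t A - A)) (𝓝[>] 0) B

/-- The domain `D(L)` of the infinitesimal generator. -/
def domain (S : QuantumMarkovSemigroup H) : Set (H →L[ℂ] H) :=
  {A | ∃ B, S.IsDerivAtZero A B}

open Classical in
/-- The infinitesimal generator `L`; it is given the value `0` off its domain. -/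
def generator (S : QuantumMarkovSemigroup H) (A : H →L[ℂ] H) : H →L[ℂ] H :=
  if hA : ∃ B, S.IsDerivAtZero A B then hA.choose else 0

/-- The domain algebra of `L`: the largest `*`-subalgebra of `B(H)` contained in `D(L)`, that is,
the supremum of all of them. Since `1 ∈ D(L)`, only unital ones have to be considered. -/
def domainAlgebra (S : QuantumMarkovSemigroup H) : StarSubalgebra ℂ (H →L[ℂ] H) :=
  sSup {M | (M : Set (H →L[ℂ] H)) ⊆ S.domain}

/-- The set `{x ∈ H : |x⟩⟨y| ∈ 𝒜}`, where `𝒜` is the domain algebra. -/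
def rankOneSpace (S : QuantumMarkovSemigroup H) (y : H) : Set H :=
  {x | InnerProductSpace.rankOne ℂ x y ∈ S.domainAlgebra}

/-- `L(A) = V* π(A) V + G A + A G*` on the domain algebra, with `π` a norm-continuous unital
`*`-representation of the domain algebra on a Hilbert space `K`, and with the vectors `π(A) V u`
(`A` in the domain algebra, `u ∈ U`) total in `K`. -/
structure IsMinimalStinespring (S : QuantumMarkovSemigroup H) (U : Set H)
    {K : Type v} [NormedAddCommGroup K] [InnerProductSpace ℂ K] [CompleteSpace K]
    (G : H →L[ℂ] H) (V : H →L[ℂ] K) (π : S.domainAlgebra →⋆ₐ[ℂ] (K →L[ℂ] K)) : Prop where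
  norm_continuous : Continuous π
  generator_eq : ∀ A : S.domainAlgebra,
    S.generator A = V.adjoint ∘L π A ∘L V + G ∘L (A : H →L[ℂ] H) + (A : H →L[ℂ] H) ∘L G.adjoint
  minimal : Dense (Submodule.span ℂ {w : K | ∃ A : S.domainAlgebra, ∃ x ∈ U, w = π A (V x)} : Set K)

end QuantumMarkovSemigroup

/-- `h` is an associate vector of the positive finite rank operator `T`: for a spectral decomposition
`T = ∑ₛ t'ₛ |k'ₛ⟩⟨k'ₛ|` with `k'` orthonormal and all `t'ₛ > 0`, put `t = ∑ₛ t'ₛ` and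
`kₛ = √t k'ₛ`; then `h = ∑ₛ ‖kₛ‖⁻² kₛ`. -/
def IsAssociateVector {H : Type*} [NormedAddCommGroup H] [InnerProductSpace ℂ H]
    (T : H →L[ℂ] H) (h : H) : Prop :=
  ∃ (m : ℕ) (k' : Fin m → H) (t' : Fin m → ℝ) (k : Fin m → H),
    Orthonormal ℂ k' ∧ (∀ s, 0 < t' s) ∧
    T = ∑ s, (t' s : ℂ) • InnerProductSpace.rankOne ℂ (k' s) (k' s) ∧
    (∀ s, k s = (Real.sqrt (∑ r, t' r) : ℂ) • k' s) ∧
    h = ∑ s, ((‖k s‖ ^ 2)⁻¹ : ℂ) • k s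

/-- A map `f` from a `*`-subalgebra `M` of `B(H)` to `B(K)` is (σ-weak, σ-weak)-closable: whenever a
net in `M` tends σ-weakly to `0` and its image under `f` tends σ-weakly to `B`, then `B = 0`. Nets
are expressed by nontrivial filters. -/
def IsSigmaWeaklyClosable {H K : Type*} [NormedAddCommGroup H] [InnerProductSpace ℂ H]
    [CompleteSpace H] [NormedAddCommGroup K] [InnerProductSpace ℂ K]
    (M : StarSubalgebra ℂ (H →L[ℂ] H)) (f : M → K →L[ℂ] K) : Prop :=
  ∀ (l : Filter M) [l.NeBot] (B : K →L[ℂ] K),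
    SigmaWeakTendsto (fun A : M => (A : H →L[ℂ] H)) l 0 → SigmaWeakTendsto f l B → B = 0

end

/-!
Let `e = T^{1/2} h`, a unit vector. Positivity of `L`, conditionally on the vector `h`, applied to
`T - |Th⟩⟨Th| = b⋆b`, where `b = (1 - |e⟩⟨e|) T^{1/2}` and `b h = 0`, bounds
`⟨h, L(|Th⟩⟨Th|) h⟩` by `⟨h, L(T) h⟩`. With this bound, augmenting a family
`(bᵢ, xᵢ)` by `(-|∑ⱼ bⱼ xⱼ⟩⟨Th|, h)` shows that `A ↦ L(A) - G A - A G⋆` is completely positive on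
the domain algebra, and Stinespring's construction dilates it. The domain algebra need not be
norm closed; still `‖a‖² - a⋆a = b⋆b` for some bounded `b`, and this suffices to bound the
representation.

If `A → 0` and `π(A) → B` along a net, then by minimality it is enough to see that the `σ`-weak
limit of `L(C⋆ A D)` vanishes. The generator is `σ`-weakly closable since
`⟨x, (T_t(A) - A) x⟩` is the integral of `⟨x, T_s(L(A)) x⟩` over `[0, t]`, a `σ`-weakly continuous
functional of `L(A)`.
-/

section SigmaWeak

variable {ι H K : Type*} [NormedAddCommGroup H] [InnerProductSpace ℂ H]
  [NormedAddCommGroup K] [InnerProductSpace ℂ K]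
  {f g : ι → H →L[ℂ] H} {l : Filter ι} {A B : H →L[ℂ] H}

theorem sigmaWeakTendsto_iff :
    SigmaWeakTendsto f l B ↔ ∀ x y : ℕ → H, (Summable fun n => ‖x n‖ ^ 2) →
      (Summable fun n => ‖y n‖ ^ 2) →
      Tendsto (fun i => ∑' n, ⟪x n, f i (y n)⟫_ℂ) l (𝓝 (∑' n, ⟪x n, B (y n)⟫_ℂ)) := by
  simp only [SigmaWeakTendsto, nhds_iInf, nhds_induced, tendsto_iInf, tendsto_comap_iff,
    Function.comp_def]

theorem SigmaWeakTendsto.inner (hf : SigmaWeakTendsto f l B) (x y : H) :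
    Tendsto (fun i => ⟪x, f i y⟫_ℂ) l (𝓝 ⟪x, B y⟫_ℂ) := by
  have hsum (z : H) : Summable fun n : ℕ => ‖(Pi.single 0 z : ℕ → H) n‖ ^ 2 :=
    summable_of_ne_finset_zero (s := {0}) fun n hn => by
      simp [Pi.single_eq_of_ne (Finset.notMem_singleton.1 hn)]
  have htsum (A : H →L[ℂ] H) :
      ∑' n, ⟪(Pi.single 0 x : ℕ → H) n, A ((Pi.single 0 y : ℕ → H) n)⟫_ℂ = ⟪x, A y⟫_ℂ := by
    rw [tsum_eq_single 0 fun n hn => by simp [Pi.single_eq_of_ne hn]]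
    simp only [Pi.single_eq_same]
  simpa only [htsum] using sigmaWeakTendsto_iff.1 hf _ _ (hsum x) (hsum y)

theorem ext_inner_self (h : ∀ x, ⟪x, A x⟫_ℂ = ⟪x, B x⟫_ℂ) : A = B :=
  ContinuousLinearMap.coe_injective <| (ext_inner_map _ _).1 fun x => by
    simpa only [ContinuousLinearMap.coe_coe, inner_conj_symm] using congrArg (starRingEnd ℂ) (h x)

theorem SigmaWeakTendsto.unique [l.NeBot] (hA : SigmaWeakTendsto f l A)
    (hB : SigmaWeakTendsto f l B) : A = B :=
  ext_inner_self fun x => tendsto_nhds_unique (hA.inner x x) (hB.inner x x)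

theorem tendsto_inner_of_tendsto_inner_self
    (hf : ∀ x, Tendsto (fun i => ⟪x, f i x⟫_ℂ) l (𝓝 ⟪x, B x⟫_ℂ)) (x y : H) :
    Tendsto (fun i => ⟪x, f i y⟫_ℂ) l (𝓝 ⟪x, B y⟫_ℂ) := by
  have hconj (z : H) : Tendsto (fun i => ⟪f i z, z⟫_ℂ) l (𝓝 ⟪B z, z⟫_ℂ) := by
    simpa only [Function.comp_def, inner_conj_symm] using
      (Complex.continuous_conj.tendsto _).comp (hf z)
  have hpol : Tendsto (fun i => ⟪f i y, x⟫_ℂ) l (𝓝 ⟪B y, x⟫_ℂ) := by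
    have hsplit (A : H →L[ℂ] H) := inner_map_polarization' (A : H →ₗ[ℂ] H) y x
    simp only [ContinuousLinearMap.coe_coe] at hsplit
    simp only [hsplit]
    exact (((hconj _).sub (hconj _)).sub ((hconj _).const_mul _)).add ((hconj _).const_mul _)
      |>.div_const _
  simpa only [Function.comp_def, inner_conj_symm] using
    (Complex.continuous_conj.tendsto _).comp hpol

theorem norm_inner_apply_le {C : ℝ} {A : H →L[ℂ] K} (hA : ‖A‖ ≤ C) (x : K) (y : H) :
    ‖⟪x, A y⟫_ℂ‖ ≤ C * (‖x‖ ^ 2 + ‖y‖ ^ 2) := by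
  have hC : 0 ≤ C := (norm_nonneg A).trans hA
  calc ‖⟪x, A y⟫_ℂ‖ ≤ ‖x‖ * (C * ‖y‖) :=
        (norm_inner_le_norm _ _).trans (by gcongr; exact A.le_of_opNorm_le hA y)
    _ = C * (‖x‖ * ‖y‖) := by ring
    _ ≤ C * (‖x‖ ^ 2 + ‖y‖ ^ 2) := by
        gcongr
        nlinarith [sq_nonneg (‖x‖ - ‖y‖), sq_nonneg ‖x‖, sq_nonneg ‖y‖]

theorem summable_inner_apply (A : H →L[ℂ] K) {x : ℕ → K} {y : ℕ → H}
    (hx : Summable fun n => ‖x n‖ ^ 2) (hy : Summable fun n => ‖y n‖ ^ 2) :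
    Summable fun n => ⟪x n, A (y n)⟫_ℂ :=
  .of_norm_bounded ((hx.add hy).mul_left ‖A‖) fun _ => norm_inner_apply_le le_rfl _ _

theorem summable_norm_sq_apply (A : H →L[ℂ] K) {x : ℕ → H} (hx : Summable fun n => ‖x n‖ ^ 2) :
    Summable fun n => ‖A (x n)‖ ^ 2 := by
  refine .of_nonneg_of_le (fun _ => sq_nonneg _) (fun n => ?_) (hx.mul_left (‖A‖ ^ 2))
  rw [← mul_pow]
  gcongr
  exact A.le_opNorm _

theorem sigmaWeakTendsto_of_bounded {C : ℝ} (hC : ∀ᶠ i in l, ‖f i‖ ≤ C)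
    (hf : ∀ x, Tendsto (fun i => ⟪x, f i x⟫_ℂ) l (𝓝 ⟪x, B x⟫_ℂ)) : SigmaWeakTendsto f l B :=
  sigmaWeakTendsto_iff.2 fun _ _ hx hy =>
    tendsto_tsum_of_dominated_convergence ((hx.add hy).mul_left C)
      (fun _ => tendsto_inner_of_tendsto_inner_self hf _ _)
      (hC.mono fun _ hi _ => norm_inner_apply_le hi _ _)

theorem SigmaWeakTendsto.add (hf : SigmaWeakTendsto f l A) (hg : SigmaWeakTendsto g l B) :
    SigmaWeakTendsto (fun i => f i + g i) l (A + B) := by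
  rw [sigmaWeakTendsto_iff] at *
  intro x y hx hy
  have hsum (A : H →L[ℂ] H) := summable_inner_apply A hx hy
  simpa only [_root_.add_apply, inner_add_right, (hsum _).tsum_add (hsum _)] using
    (hf x y hx hy).add (hg x y hx hy)

theorem SigmaWeakTendsto.sandwich [CompleteSpace H] [CompleteSpace K]
    (hf : SigmaWeakTendsto f l B) (V : H →L[ℂ] K) (W : K →L[ℂ] H) :
    SigmaWeakTendsto (fun i => V ∘L f i ∘L W) l (V ∘L B ∘L W) := by
  rw [sigmaWeakTendsto_iff] at *
  intro x y hx hy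
  simpa only [ContinuousLinearMap.comp_apply, ContinuousLinearMap.adjoint_inner_left] using
    hf _ _ (summable_norm_sq_apply V.adjoint hx) (summable_norm_sq_apply W hy)

theorem exists_tendsto_inner_of_norm_le [CompleteSpace H] (l : Ultrafilter ι) {z : ι → H} {C : ℝ}
    (hz : ∀ᶠ i in (l : Filter ι), ‖z i‖ ≤ C) :
    ∃ w : H, ‖w‖ ≤ C ∧ ∀ x, Tendsto (fun i => ⟪x, z i⟫_ℂ) l (𝓝 ⟪x, w⟫_ℂ) := by
  let toDual := InnerProductSpace.toDual ℂ H
  obtain ⟨φ, hφ, hlim⟩ := (WeakDual.isCompact_closedBall (𝕜 := ℂ) (0 : StrongDual ℂ H) C)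
    |>.ultrafilter_le_nhds (l.map fun i => StrongDual.toWeakDual (toDual (z i)))
      (le_principal_iff.2 <| hz.mono fun i hi => by
        simpa [toDual] using hi)
  obtain ⟨w, rfl⟩ : ∃ w, StrongDual.toWeakDual (toDual w) = φ :=
    ⟨toDual.symm (WeakDual.toStrongDual φ), by simp⟩
  refine ⟨w, by simpa [toDual] using hφ, fun x => ?_⟩
  have heval : Tendsto (fun i => ⟪z i, x⟫_ℂ) l (𝓝 ⟪w, x⟫_ℂ) :=
    ((WeakDual.eval_continuous x).tendsto _).comp hlim
  simpa only [Function.comp_def, inner_conj_symm] using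
    (Complex.continuous_conj.tendsto _).comp heval

theorem exists_tendsto_inner_of_opNorm_le [CompleteSpace H] (l : Ultrafilter ι) {C : ℝ}
    (hC : ∀ᶠ i in (l : Filter ι), ‖f i‖ ≤ C) :
    ∃ B : H →L[ℂ] H, ∀ x y, Tendsto (fun i => ⟪x, f i y⟫_ℂ) l (𝓝 ⟪x, B y⟫_ℂ) := by
  choose b hb hlim using fun y => exists_tendsto_inner_of_norm_le l
    (hC.mono fun i hi => (f i).le_of_opNorm_le hi y)
  have hadd (y y' : H) : b (y + y') = b y + b y' :=
    ext_inner_left ℂ fun x => tendsto_nhds_unique (hlim _ x) (by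
      simpa only [map_add, inner_add_right] using (hlim y x).add (hlim y' x))
  have hsmul (c : ℂ) (y : H) : b (c • y) = c • b y :=
    ext_inner_left ℂ fun x => tendsto_nhds_unique (hlim _ x) (by
      simpa only [map_smul, inner_smul_right] using (hlim y x).const_mul c)
  exact ⟨LinearMap.mkContinuous ⟨⟨b, hadd⟩, hsmul⟩ C hb, fun x y => hlim y x⟩

end SigmaWeak

section Stinespring

variable {𝔄 : Type u} [CStarAlgebra 𝔄] [PartialOrder 𝔄] [StarOrderedRing 𝔄]
  {H : Type v} [NormedAddCommGroup H] [InnerProductSpace ℂ H] [CompleteSpace H]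

/-- Complete positivity of a linear map from a `*`-subalgebra `M` of a C⋆-algebra `𝔄` to `B(H)`.
The elements `b i` are only required to have their products `star (b i) * b j` in `M`: since `M`
need not be closed, these `b i` can include square roots taken in `𝔄`. -/
structure IsCompletelyPositiveOn (M : StarSubalgebra ℂ 𝔄) (Ψ : M →ₗ[ℂ] (H →L[ℂ] H)) : Prop where
  map_star : ∀ a, Ψ (star a) = star (Ψ a)
  re_sum_inner_nonneg : ∀ {ι : Type u} (s : Finset ι) (b : ι → 𝔄)
    (hb : ∀ i j, star (b i) * b j ∈ M) (x : ι → H),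
    0 ≤ (∑ i ∈ s, ∑ j ∈ s, ⟪x i, Ψ ⟨star (b i) * b j, hb i j⟩ (x j)⟫_ℂ).re

theorem sum_inner_star_mul_self {ι : Type*} [Fintype ι] (R : CStarMatrix ι ι (H →L[ℂ] H))
    (x : ι → H) :
    ∑ i, ∑ j, ⟪x i, (star R * R) i j (x j)⟫_ℂ
      = ∑ k, ⟪∑ i, R k i (x i), ∑ i, R k i (x i)⟫_ℂ := by
  have hentry (i j : ι) : ⟪x i, (star R * R) i j (x j)⟫_ℂ = ∑ k, ⟪R k i (x i), R k j (x j)⟫_ℂ := by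
    simp only [CStarMatrix.mul_apply, CStarMatrix.star_apply, _root_.sum_apply, inner_sum,
      ContinuousLinearMap.star_eq_adjoint, mul_apply_eq_comp,
      ContinuousLinearMap.adjoint_inner_right]
  simp only [hentry, inner_sum, sum_inner]
  rw [Finset.sum_comm_cycle]
  exact Finset.sum_congr rfl fun _ _ => Finset.sum_comm

theorem re_sum_inner_nonneg_of_cstarMatrix_nonneg {ι : Type*} [Fintype ι]
    {N : CStarMatrix ι ι (H →L[ℂ] H)} (hN : 0 ≤ N) (x : ι → H) :
    0 ≤ (∑ i, ∑ j, ⟪x i, N i j (x j)⟫_ℂ).re := by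
  rw [StarOrderedRing.nonneg_iff] at hN
  induction hN using AddSubmonoid.closure_induction with
  | mem N hN =>
    obtain ⟨R, rfl⟩ := hN
    simp only [sum_inner_star_mul_self, Complex.re_sum]
    exact Finset.sum_nonneg fun k _ => inner_self_nonneg (𝕜 := ℂ)
  | zero => simp
  | add A B _ _ hA hB =>
    simpa only [CStarMatrix.add_apply, _root_.add_apply, inner_add_right, Finset.sum_add_distrib,
      Complex.add_re] using add_nonneg hA hB

theorem re_sum_inner_map_star_mul_nonneg (φ : 𝔄 →CP (H →L[ℂ] H)) {ι : Type*} (s : Finset ι)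
    (b : ι → 𝔄) (x : ι → H) :
    0 ≤ (∑ i ∈ s, ∑ j ∈ s, ⟪x i, φ (star (b i) * b j) (x j)⟫_ℂ).re := by
  classical
  rcases s.eq_empty_or_nonempty with rfl | ⟨i₀, hi₀⟩
  · simp
  let R : CStarMatrix s s 𝔄 := CStarMatrix.ofMatrix fun k j => if k = ⟨i₀, hi₀⟩ then b j else 0
  have hR₀ (k j : s) : R k j = if k = ⟨i₀, hi₀⟩ then b j else 0 := rfl
  have hR (i j : s) : (star R * R) i j = star (b i) * b j := by
    rw [CStarMatrix.mul_apply, Finset.sum_eq_single ⟨i₀, hi₀⟩]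
    · simp [CStarMatrix.star_apply, hR₀]
    · intro k _ hk
      simp [hR₀, hk]
    · simp
  have h := re_sum_inner_nonneg_of_cstarMatrix_nonneg
    (φ.map_cstarMatrix_nonneg _ (star_mul_self_nonneg R)) fun i : s => x i
  simpa only [CStarMatrix.map_apply, hR, ← Finset.sum_coe_sort s] using h

theorem exists_star_mul_self_eq_norm_sq_sub (c : 𝔄) :
    ∃ d : 𝔄, star d * d = algebraMap ℝ 𝔄 (‖c‖ ^ 2) - star c * c :=
  (CStarAlgebra.nonneg_iff_eq_star_mul_self.1
    (sub_nonneg.2 CStarAlgebra.star_mul_le_algebraMap_norm_sq)).imp fun _ => Eq.symm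

theorem eq_of_inner_eq_of_dense_span {K : Type*} [NormedAddCommGroup K] [InnerProductSpace ℂ K]
    {s : Set K} (hs : Dense (Submodule.span ℂ s : Set K)) {z w : K}
    (h : ∀ x ∈ s, ⟪x, z⟫_ℂ = ⟪x, w⟫_ℂ) : z = w :=
  hs.eq_of_inner_right ℂ fun x hx => by
    induction hx using Submodule.span_induction with
    | mem x hx => exact h x hx
    | zero => simp only [inner_zero_left]
    | add x y _ _ hx hy => simp only [inner_add_left, hx, hy]
    | smul c x _ hx => simp only [inner_smul_left, hx]

variable {M : StarSubalgebra ℂ 𝔄} {Ψ : M →ₗ[ℂ] (H →L[ℂ] H)}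

omit [PartialOrder 𝔄] [StarOrderedRing 𝔄] in
theorem IsCompletelyPositiveOn.posSemidef (hΨ : IsCompletelyPositiveOn M Ψ) :
    (Matrix.of fun a b : M => Ψ (star a * b)).PosSemidef := by
  have htfae := RKHS.posSemidef_tfae (K := Matrix.of fun a b : M => Ψ (star a * b)) |>.out 0 2
  refine htfae.2 ⟨?_, fun x => ?_⟩
  · ext1 a b
    simp [← hΨ.map_star]
  · have h := hΨ.re_sum_inner_nonneg x.support (fun a => (a : 𝔄))
      (fun a b => mul_mem (star_mem a.2) b.2) x
    rw [Finset.sum_comm, Complex.re_sum] at h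
    simp only [Finsupp.sum, RCLike.re_to_complex, Complex.re_sum, Matrix.of_apply] at h ⊢
    convert h using 3 with b _ a _
    exact inner_re_symm (𝕜 := ℂ) _ _

omit [PartialOrder 𝔄] [StarOrderedRing 𝔄] in
theorem IsCompletelyPositiveOn.exists_kolmogorov (hΨ : IsCompletelyPositiveOn M Ψ) :
    ∃ (K : Type (max u v)) (_ : NormedAddCommGroup K) (_ : InnerProductSpace ℂ K)
      (_ : CompleteSpace K) (v : M → H →L[ℂ] K),
      (∀ a b x y, ⟪v a x, v b y⟫_ℂ = ⟪x, Ψ (star a * b) y⟫_ℂ) ∧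
      Dense (Submodule.span ℂ {w | ∃ a x, v a x = w} : Set K) := by
  let k : Matrix M M (H →L[ℂ] H) := .of fun a b => Ψ (star a * b)
  have : Fact k.PosSemidef := ⟨hΨ.posSemidef⟩
  refine ⟨RKHS.OfKernel k, inferInstance, inferInstance, inferInstance,
    RKHS.kerFun (RKHS.OfKernel k), fun a b x y => ?_, ?_⟩
  · have hk : k b a = (k a b).adjoint := by
      simp [k, ← ContinuousLinearMap.star_eq_adjoint, ← hΨ.map_star]
    rw [← RKHS.kernel_inner, RKHS.OfKernel.kernel_ofKernel, hk,
      ContinuousLinearMap.adjoint_inner_left]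
    rfl
  · rw [Submodule.dense_iff_topologicalClosure_eq_top]
    exact RKHS.kerFun_dense _

section Kolmogorov

variable {K : Type*} [NormedAddCommGroup K] [InnerProductSpace ℂ K] {v : M → H →L[ℂ] K}
  (hv : ∀ a b x y, ⟪v a x, v b y⟫_ℂ = ⟪x, Ψ (star a * b) y⟫_ℂ)

include hv

theorem IsCompletelyPositiveOn.norm_sum_mul_le (hΨ : IsCompletelyPositiveOn M Ψ) (c : M)
    (s : Finset M) (x : M → H) : ‖∑ a ∈ s, v (c * a) (x a)‖ ≤ ‖c‖ * ‖∑ a ∈ s, v a (x a)‖ := by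
  obtain ⟨d, hd⟩ := exists_star_mul_self_eq_norm_sq_sub (c : 𝔄)
  have hmul (a b : M) : star (d * (a : 𝔄)) * (d * (b : 𝔄))
      = (((‖c‖ : ℂ) ^ 2 • (star a * b) - star (c * a) * (c * b) : M) : 𝔄) := by
    have hassoc : star (d * (a : 𝔄)) * (d * (b : 𝔄)) = star (a : 𝔄) * (star d * d) * b := by
      simp only [star_mul, mul_assoc]
    rw [hassoc, hd]
    simp [mul_sub, sub_mul, mul_assoc, Algebra.algebraMap_eq_smul_one, ← Complex.coe_smul]
  have hpos := hΨ.re_sum_inner_nonneg s (fun a => d * (a : 𝔄))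
    (fun a b => by rw [hmul]; exact Subtype.coe_prop _) x
  simp only [hmul, Subtype.coe_eta, map_sub, map_smul, _root_.sub_apply, _root_.smul_apply,
    inner_sub_right, inner_smul_right, Finset.sum_sub_distrib, ← Finset.mul_sum, ← hv,
    ← sum_inner, ← inner_sum, inner_self_eq_norm_sq_to_K] at hpos
  have hsq : ‖∑ a ∈ s, v (c * a) (x a)‖ ^ 2 ≤ ‖c‖ ^ 2 * ‖∑ a ∈ s, v a (x a)‖ ^ 2 := by
    simpa [← Complex.ofReal_pow, ← Complex.ofReal_mul] using hpos
  rw [← mul_pow] at hsq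
  exact le_of_sq_le_sq hsq (by positivity)

variable (hdense : Dense (Submodule.span ℂ {w | ∃ a x, v a x = w} : Set K))

include hdense

omit [PartialOrder 𝔄] [StarOrderedRing 𝔄] [CompleteSpace H] in
theorem isLinearMap_of_kolmogorov : IsLinearMap ℂ v where
  map_add a b := by
    ext1 x
    refine eq_of_inner_eq_of_dense_span hdense ?_
    rintro _ ⟨c, y, rfl⟩
    simp only [inner_add_right, hv, mul_add, map_add, _root_.add_apply]
  map_smul r a := by
    ext1 x
    refine eq_of_inner_eq_of_dense_span hdense ?_
    rintro _ ⟨c, y, rfl⟩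
    simp only [inner_smul_right, hv, mul_smul_comm, map_smul, _root_.smul_apply]

theorem IsCompletelyPositiveOn.exists_leftMul [CompleteSpace K] (hΨ : IsCompletelyPositiveOn M Ψ)
    (c : M) : ∃ p : K →L[ℂ] K, ‖p‖ ≤ ‖c‖ ∧ ∀ a x, p (v a x) = v (c * a) x := by
  let e : (M →₀ H) →ₗ[ℂ] K := Finsupp.lsum ℂ fun a => (v a).toLinearMap
  let f : (M →₀ H) →ₗ[ℂ] K := Finsupp.lsum ℂ fun a => (v (c * a)).toLinearMap
  have he : DenseRange e := by
    refine hdense.mono (Submodule.span_le.2 ?_ : _ ≤ LinearMap.range e)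
    rintro _ ⟨a, x, rfl⟩
    exact ⟨Finsupp.single a x, by simp [e]⟩
  have hf (g : M →₀ H) : ‖f g‖ ≤ ‖c‖ * ‖e g‖ := by
    simpa only [e, f, Finsupp.lsum_apply, Finsupp.sum, ContinuousLinearMap.coe_coe] using
      hΨ.norm_sum_mul_le hv c g.support g
  refine ⟨f.extendOfNorm e, LinearMap.opNorm_extendOfNorm_le he (norm_nonneg c) hf, fun a x => ?_⟩
  simpa only [e, f, Finsupp.lsum_single, ContinuousLinearMap.coe_coe] using
    LinearMap.extendOfNorm_eq he ⟨‖c‖, hf⟩ (Finsupp.single a x)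

theorem IsCompletelyPositiveOn.exists_representation [CompleteSpace K]
    (hΨ : IsCompletelyPositiveOn M Ψ) :
    ∃ π : M →⋆ₐ[ℂ] (K →L[ℂ] K), (∀ c, ‖π c‖ ≤ ‖c‖) ∧ ∀ c a x, π c (v a x) = v (c * a) x := by
  choose p hp_norm hp using hΨ.exists_leftMul hv hdense
  have hlin := isLinearMap_of_kolmogorov hv hdense
  have hext {P Q : K →L[ℂ] K} (h : ∀ a x, P (v a x) = Q (v a x)) : P = Q :=
    ContinuousLinearMap.ext_on hdense (by rintro _ ⟨a, x, rfl⟩; exact h a x)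
  exact ⟨
    { toFun := p
      map_one' := hext fun a x => by simp [hp]
      map_mul' := fun c d => hext fun a x => by simp [hp, mul_assoc]
      map_zero' := hext fun a x => by simp [hp, hlin.map_zero]
      map_add' := fun c d => hext fun a x => by simp [hp, add_mul, hlin.map_add]
      commutes' := fun r => hext fun a x => by
        simp [hp, Algebra.algebraMap_eq_smul_one, hlin.map_smul]
      map_star' := fun c => hext fun a x => eq_of_inner_eq_of_dense_span hdense (by
        rintro _ ⟨b, y, rfl⟩
        simp only [ContinuousLinearMap.star_eq_adjoint, ContinuousLinearMap.adjoint_inner_right,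
          hp, hv, star_mul, mul_assoc]) },
    hp_norm, hp⟩

end Kolmogorov

/-- **Stinespring's theorem**, for a `*`-subalgebra that need not be closed. -/
theorem IsCompletelyPositiveOn.exists_stinespring (hΨ : IsCompletelyPositiveOn M Ψ) :
    ∃ (K : Type (max u v)) (_ : NormedAddCommGroup K) (_ : InnerProductSpace ℂ K)
      (_ : CompleteSpace K) (V : H →L[ℂ] K) (π : M →⋆ₐ[ℂ] (K →L[ℂ] K)),
      (∀ a, Ψ a = V.adjoint ∘L π a ∘L V) ∧ (∀ a, ‖π a‖ ≤ ‖a‖) ∧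
      Dense (Submodule.span ℂ {w : K | ∃ a x, w = π a (V x)} : Set K) := by
  obtain ⟨K, _, _, _, v, hv, hdense⟩ := hΨ.exists_kolmogorov
  obtain ⟨π, hπ_norm, hπ⟩ := hΨ.exists_representation hv hdense
  refine ⟨K, inferInstance, inferInstance, inferInstance, v 1, π, fun a => ?_, hπ_norm, ?_⟩
  · ext1 x
    refine ext_inner_left ℂ fun y => ?_
    simp only [ContinuousLinearMap.comp_apply, ContinuousLinearMap.adjoint_inner_right, hπ, hv,
      star_one, one_mul, mul_one]
  · simpa only [hπ, mul_one, eq_comm] using hdense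

end Stinespring

section NormalFunctional

open InnerProductSpace ComplexOrder

variable {ι H : Type*} [NormedAddCommGroup H] [InnerProductSpace ℂ H]

theorem exists_nat_tsum_inner_eq {w : ι → H} (hw : Summable fun i => ‖w i‖ ^ 2) :
    ∃ w' : ℕ → H, (Summable fun n => ‖w' n‖ ^ 2) ∧
      ∀ A : H →L[ℂ] H, ∑' n, ⟪w' n, A (w' n)⟫_ℂ = ∑' i, ⟪w i, A (w i)⟫_ℂ := by
  let s := Function.support fun i => ‖w i‖ ^ 2
  obtain ⟨j, hj⟩ := hw.countable_support.exists_injective_nat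
  let w' : ℕ → H := Function.extend j (fun i : s => w i) 0
  have hextend {E : Type} [Zero E] {g : H → E} (hg : g 0 = 0) :
      (fun n => g (w' n)) = Function.extend j (fun i : s => g (w i)) 0 := by
    ext n
    rw [Function.apply_extend g]
    exact congrArg (Function.extend j _ · n) (funext fun _ => hg)
  refine ⟨w', ?_, fun A => ?_⟩
  · rw [hextend (g := fun z => ‖z‖ ^ 2) (by simp), summable_extend_zero hj]
    exact hw.subtype s
  · rw [hextend (g := fun z => ⟪z, A z⟫_ℂ) (by simp), tsum_extend_zero hj]
    refine tsum_subtype_eq_of_support_subset (f := fun i => ⟪w i, A (w i)⟫_ℂ) fun i hi => ?_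
    contrapose! hi
    simp_all [s]

variable [CompleteSpace H]

theorem norm_map_star_mul_le {𝔄 : Type*} [CStarAlgebra 𝔄] [PartialOrder 𝔄] [StarOrderedRing 𝔄]
    (ψ : 𝔄 →ₚ[ℂ] ℂ) (a b : 𝔄) :
    ‖ψ (star a * b)‖ ≤ √(ψ (star a * a)).re * √(ψ (star b * b)).re :=
  norm_inner_le_norm (𝕜 := ℂ) (ψ.toPreGNS a) (ψ.toPreGNS b)

theorem exists_map_rankOne_eq (ψ : (H →L[ℂ] H) →ₚ[ℂ] ℂ) :
    ∃ R : H →L[ℂ] H, IsSelfAdjoint R ∧ ∀ x y, ψ (rankOne ℂ x y) = ⟪R y, R x⟫_ℂ := by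
  obtain ⟨C, hC⟩ := ψ.exists_norm_apply_le
  let ρ : H →L[ℂ] H := continuousLinearMapOfBilin <|
    (LinearMap.mk₂'ₛₗ (starRingEnd ℂ) (RingHom.id ℂ) (fun y x => ψ (rankOne ℂ x y))
      (by simp) (by simp) (by simp) (by simp)).mkContinuous₂ C fun y x => by
        simpa only [LinearMap.mk₂'ₛₗ_apply, norm_rankOne, mul_assoc, mul_comm ‖x‖] using
          hC (rankOne ℂ x y)
  have hρ (x y : H) : ⟪ρ y, x⟫_ℂ = ψ (rankOne ℂ x y) := continuousLinearMapOfBilin_apply _ y x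
  have hρ_nonneg : 0 ≤ ρ := by
    rw [ContinuousLinearMap.nonneg_iff_isPositive, ContinuousLinearMap.isPositive_iff_complex]
    intro x
    have hx : 0 ≤ ψ (rankOne ℂ x x) := map_nonneg ψ
      ((ContinuousLinearMap.nonneg_iff_isPositive _).2 (isPositive_rankOne_self x))
    rw [hρ]
    exact ⟨(Complex.eq_re_of_ofReal_le hx).symm, (Complex.le_def.1 hx).1⟩
  obtain ⟨R, hR, hRρ⟩ := CStarAlgebra.nonneg_iff_exists_isSelfAdjoint_and_eq_mul_self.1 hρ_nonneg
  refine ⟨R, hR, fun x y => ?_⟩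
  rw [← hρ, hRρ, mul_apply_eq_comp]
  exact hR.isSymmetric (R y) x

/-- The orthogonal projection onto the span of finitely many vectors of a Hilbert basis. -/
noncomputable def basisProj (e : HilbertBasis ι ℂ H) (F : Finset ι) : H →L[ℂ] H :=
  ∑ i ∈ F, rankOne ℂ (e i) (e i)

variable (e : HilbertBasis ι ℂ H)

omit [CompleteSpace H] in
theorem mul_basisProj (A : H →L[ℂ] H) (F : Finset ι) :
    A * basisProj e F = ∑ i ∈ F, rankOne ℂ (A (e i)) (e i) := by
  rw [basisProj, Finset.mul_sum]
  exact Finset.sum_congr rfl fun i _ => comp_rankOne _ _ _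

theorem isStarProjection_basisProj (F : Finset ι) : IsStarProjection (basisProj e F) where
  isIdempotentElem := by
    classical
    rw [IsIdempotentElem, mul_basisProj]
    refine Finset.sum_congr rfl fun i hi => ?_
    simp [basisProj, orthonormal_iff_ite.1 e.orthonormal, hi]
  isSelfAdjoint := isSelfAdjoint_sum _ fun i _ => (isPositive_rankOne_self (e i)).isSelfAdjoint

theorem monotone_basisProj : Monotone (basisProj e) := fun _ _ hFG =>
  Finset.sum_le_sum_of_subset_of_nonneg hFG fun i _ _ =>
    (ContinuousLinearMap.nonneg_iff_isPositive _).2 (isPositive_rankOne_self (e i))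

theorem sigmaWeakTendsto_mul_basisProj (A : H →L[ℂ] H) :
    SigmaWeakTendsto (fun F => A * basisProj e F) atTop A := by
  refine sigmaWeakTendsto_of_bounded (C := ‖A‖) (.of_forall fun F => ?_) fun x => ?_
  · exact (norm_mul_le _ _).trans
      (mul_le_of_le_one_right (norm_nonneg A) (isStarProjection_basisProj e F).norm_le)
  · have hx : Tendsto (fun F => basisProj e F x) atTop (𝓝 x) := by
      simpa [basisProj, HasSum, e.repr_apply_apply] using e.hasSum_repr x
    exact tendsto_const_nhds.inner ((A.continuous.tendsto x).comp hx)

theorem tendsto_map_mul_basisProj {ψ : (H →L[ℂ] H) →ₚ[ℂ] ℂ}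
    (hψ : Tendsto (fun F => ψ (1 - basisProj e F)) atTop (𝓝 0)) (A : H →L[ℂ] H) :
    Tendsto (fun F => ψ (A * basisProj e F)) atTop (𝓝 (ψ A)) := by
  have hbound (F : Finset ι) : ‖ψ (A * basisProj e F) - ψ A‖
      ≤ √(ψ (A * star A)).re * √(ψ (1 - basisProj e F)).re := by
    have hQ := (isStarProjection_basisProj e F).one_sub
    have h := norm_map_star_mul_le ψ (star A) (1 - basisProj e F)
    rw [hQ.isSelfAdjoint.star_eq, hQ.isIdempotentElem.eq, star_star] at h
    rwa [mul_sub, mul_one, map_sub, norm_sub_rev] at h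
  have hsqrt : Tendsto (fun F => √(ψ (1 - basisProj e F)).re) atTop (𝓝 0) := by
    simpa only [Function.comp_def, Complex.zero_re, Real.sqrt_zero] using
      (Real.continuous_sqrt.tendsto _).comp ((Complex.continuous_re.tendsto _).comp hψ)
  rw [tendsto_iff_norm_sub_tendsto_zero]
  exact squeeze_zero (fun _ => norm_nonneg _) hbound (by simpa using hsqrt.const_mul _)

section

variable {ψ : (H →L[ℂ] H) →ₚ[ℂ] ℂ} {R : H →L[ℂ] H}
  (hψR : ∀ x y, ψ (rankOne ℂ x y) = ⟪R y, R x⟫_ℂ)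

include hψR

theorem summable_norm_sq_of_map_rankOne_eq : Summable fun i => ‖R (e i)‖ ^ 2 := by
  refine summable_of_sum_le (c := (ψ 1).re) (fun i => sq_nonneg _) fun F => ?_
  have hle := (Complex.le_def.1 (OrderHomClass.mono ψ (isStarProjection_basisProj e F).le_one)).1
  rw [basisProj, map_sum, Complex.re_sum] at hle
  simp only [hψR, inner_self_eq_norm_sq_to_K] at hle
  simpa [← Complex.ofReal_pow] using hle

theorem map_rankOne_eq_tsum_inner (hR : IsSelfAdjoint R) (x y : H) :
    ψ (rankOne ℂ x y) = ∑' i, ⟪R (e i), rankOne ℂ x y (R (e i))⟫_ℂ := by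
  rw [hψR, ← e.tsum_inner_mul_inner (R y) (R x)]
  refine tsum_congr fun i => ?_
  rw [rankOne_apply, inner_smul_right]
  exact congrArg₂ _ (hR.isSymmetric y (e i)) (hR.isSymmetric (e i) x).symm

end

/-- A positive functional that is continuous along the finite rank projections of a Hilbert basis is
given by a positive trace class operator. -/
theorem exists_eq_tsum_inner {ψ : (H →L[ℂ] H) →ₚ[ℂ] ℂ}
    (hψ : Tendsto (fun F => ψ (1 - basisProj e F)) atTop (𝓝 0)) :
    ∃ w : ℕ → H, (Summable fun n => ‖w n‖ ^ 2) ∧ ∀ A, ψ A = ∑' n, ⟪w n, A (w n)⟫_ℂ := by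
  obtain ⟨R, hR, hψR⟩ := exists_map_rankOne_eq ψ
  obtain ⟨w, hw, hwR⟩ := exists_nat_tsum_inner_eq (summable_norm_sq_of_map_rankOne_eq e hψR)
  refine ⟨w, hw, fun A => tendsto_nhds_unique (tendsto_map_mul_basisProj e hψ A) ?_⟩
  have hfinite (F : Finset ι) :
      ψ (A * basisProj e F) = ∑' n, ⟪w n, (A * basisProj e F) (w n)⟫_ℂ := by
    rw [mul_basisProj, map_sum]
    simp only [_root_.sum_apply, inner_sum]
    rw [Summable.tsum_finsetSum fun i _ => summable_inner_apply _ hw hw]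
    simp only [hwR, map_rankOne_eq_tsum_inner e hψR hR]
  simpa only [hfinite] using sigmaWeakTendsto_iff.1 (sigmaWeakTendsto_mul_basisProj e A) w w hw hw

end NormalFunctional

section MultDefect

variable {𝔄 : Type u} [CStarAlgebra 𝔄] [PartialOrder 𝔄] [StarOrderedRing 𝔄]
  {H : Type v} [NormedAddCommGroup H] [InnerProductSpace ℂ H] [CompleteSpace H]
  {φ : 𝔄 →CP (H →L[ℂ] H)}

theorem exists_isometric_dilation (hφ : φ 1 = 1) :
    ∃ (K : Type (max u v)) (_ : NormedAddCommGroup K) (_ : InnerProductSpace ℂ K)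
      (_ : CompleteSpace K) (V : H →L[ℂ] K) (π : 𝔄 →⋆ₐ[ℂ] (K →L[ℂ] K)),
      V.adjoint ∘L V = 1 ∧ ∀ a, φ a = V.adjoint ∘L π a ∘L V := by
  have hcp : IsCompletelyPositiveOn (⊤ : StarSubalgebra ℂ 𝔄)
      (φ.toLinearMap ∘ₗ (⊤ : StarSubalgebra ℂ 𝔄).toSubalgebra.val.toLinearMap) :=
    ⟨fun a => StarHomClass.map_star φ (a : 𝔄),
      fun s b _ x => re_sum_inner_map_star_mul_nonneg φ s b x⟩
  obtain ⟨K, _, _, _, V, π, hV, -, -⟩ := hcp.exists_stinespring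
  refine ⟨K, inferInstance, inferInstance, inferInstance, V,
    π.comp ((StarAlgHom.id ℂ 𝔄).codRestrict ⊤ fun _ => trivial), ?_, fun a => hV ⟨a, trivial⟩⟩
  have hV_one := hV 1
  rw [map_one π] at hV_one
  exact hV_one.symm.trans hφ

section Isometry

variable {K : Type*} [NormedAddCommGroup K] [InnerProductSpace ℂ K] [CompleteSpace K]
  {V : H →L[ℂ] K} (hV : V.adjoint ∘L V = 1)

include hV

theorem norm_le_one_of_adjoint_comp_self : ‖V‖ ≤ 1 := by
  have hsq : ‖V‖ * ‖V‖ ≤ 1 := by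
    rw [← V.norm_adjoint_comp_self, hV]
    exact ContinuousLinearMap.norm_id_le
  nlinarith

theorem isStarProjection_one_sub_comp_adjoint : IsStarProjection (1 - V ∘L V.adjoint) :=
  IsStarProjection.one_sub
    { isIdempotentElem := by
        change V ∘L (V.adjoint ∘L V) ∘L V.adjoint = _
        rw [hV]
        rfl
      isSelfAdjoint := by
        rw [IsSelfAdjoint, ContinuousLinearMap.star_eq_adjoint, ContinuousLinearMap.adjoint_comp,
          ContinuousLinearMap.adjoint_adjoint] }

end Isometry

theorem norm_map_le_of_map_one (hφ : φ 1 = 1) (a : 𝔄) : ‖φ a‖ ≤ ‖a‖ := by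
  obtain ⟨K, _, _, _, V, π, hV, hπ⟩ := exists_isometric_dilation hφ
  have hV_norm := norm_le_one_of_adjoint_comp_self hV
  calc ‖φ a‖ ≤ ‖V.adjoint‖ * (‖π a‖ * ‖V‖) := by
        rw [hπ]
        exact (ContinuousLinearMap.opNorm_comp_le _ _).trans
          (mul_le_mul_of_nonneg_left (ContinuousLinearMap.opNorm_comp_le _ _) (norm_nonneg _))
    _ ≤ 1 * (‖a‖ * 1) := by
        rw [LinearIsometryEquiv.norm_map]
        gcongr
        exact NonUnitalStarAlgHom.norm_apply_le π a
    _ = ‖a‖ := by ring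

/-- How far `φ` is from being multiplicative at `a`, as measured by the Schwarz inequality
`φ(a)⋆φ(a) ≤ φ(a⋆a)`. The square root makes this a seminorm. -/
noncomputable def multDefect (φ : 𝔄 →CP (H →L[ℂ] H)) (a : 𝔄) : ℝ :=
  √‖φ (star a * a) - star (φ a) * φ a‖

/-- In a dilation `φ(a) = V⋆ π(a) V` with `V` isometric, take `X a = (1 - V V⋆) π(a) V`. -/
theorem exists_adjoint_comp_eq_map_mul_sub (hφ : φ 1 = 1) :
    ∃ (K : Type (max u v)) (_ : NormedAddCommGroup K) (_ : InnerProductSpace ℂ K)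
      (_ : CompleteSpace K) (X : 𝔄 → H →L[ℂ] K), (∀ a b, X (a + b) = X a + X b) ∧
      (∀ a b, (X a).adjoint ∘L X b = φ (star a * b) - star (φ a) * φ b) ∧
      ∀ a b, ‖X (a * b)‖ ≤ ‖a‖ * ‖X b‖ + ‖X a‖ * ‖b‖ := by
  obtain ⟨K, _, _, _, V, π, hV, hπ⟩ := exists_isometric_dilation hφ
  have hP := isStarProjection_one_sub_comp_adjoint hV
  set P : K →L[ℂ] K := 1 - V ∘L V.adjoint with hP_def
  refine ⟨K, inferInstance, inferInstance, inferInstance, fun a => P ∘L π a ∘L V,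
    fun a b => ?_, fun a b => ?_, fun a b => ?_⟩
  · simp only [map_add, ContinuousLinearMap.add_comp, ContinuousLinearMap.comp_add]
  · have hPP (z : K) : P.adjoint (P z) = z - V (V.adjoint z) := by
      rw [← ContinuousLinearMap.star_eq_adjoint, hP.isSelfAdjoint.star_eq, ← mul_apply_eq_comp,
        hP.isIdempotentElem.eq]
      rfl
    rw [← StarHomClass.map_star φ]
    ext x
    simp only [hπ, ContinuousLinearMap.adjoint_comp, ContinuousLinearMap.comp_apply, hPP,
      map_sub, map_mul, map_star, mul_apply_eq_comp, _root_.sub_apply,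
      ContinuousLinearMap.star_eq_adjoint]
  · have hleibniz : P ∘L π (a * b) ∘L V = P ∘L π a ∘L (P ∘L π b ∘L V) + (P ∘L π a ∘L V) ∘L φ b := by
      ext x
      simp only [hπ, hP_def, map_mul, mul_apply_eq_comp, ContinuousLinearMap.comp_apply,
        _root_.add_apply, _root_.sub_apply, map_sub, one_apply_eq_self]
      abel
    have hπ_norm : ‖P ∘L π a‖ ≤ ‖a‖ := (norm_mul_le P (π a)).trans <|
      mul_le_of_le_one_left (norm_nonneg _) hP.norm_le |>.trans
        (NonUnitalStarAlgHom.norm_apply_le π a)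
    simp only [hleibniz]
    refine (norm_add_le _ _).trans (add_le_add ?_ ?_)
    · exact (ContinuousLinearMap.opNorm_comp_le (P ∘L π a) _).trans (by gcongr)
    · exact (ContinuousLinearMap.opNorm_comp_le _ _).trans
        (by gcongr; exact norm_map_le_of_map_one hφ b)

theorem norm_eq_multDefect {K : Type*} [NormedAddCommGroup K] [InnerProductSpace ℂ K]
    [CompleteSpace K] {X : 𝔄 → H →L[ℂ] K}
    (hX : ∀ a b, (X a).adjoint ∘L X b = φ (star a * b) - star (φ a) * φ b) (a : 𝔄) :
    ‖X a‖ = multDefect φ a := by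
  rw [multDefect, ← hX, ContinuousLinearMap.norm_adjoint_comp_self,
    Real.sqrt_mul_self (norm_nonneg _)]

theorem multDefect_add_le (hφ : φ 1 = 1) (a b : 𝔄) :
    multDefect φ (a + b) ≤ multDefect φ a + multDefect φ b := by
  obtain ⟨K, _, _, _, X, hadd, hX, -⟩ := exists_adjoint_comp_eq_map_mul_sub hφ
  simp only [← norm_eq_multDefect hX, hadd]
  exact norm_add_le _ _

theorem multDefect_mul_le (hφ : φ 1 = 1) (a b : 𝔄) :
    multDefect φ (a * b) ≤ ‖a‖ * multDefect φ b + multDefect φ a * ‖b‖ := by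
  obtain ⟨K, _, _, _, X, -, hX, hmul⟩ := exists_adjoint_comp_eq_map_mul_sub hφ
  simpa only [← norm_eq_multDefect hX] using hmul a b

theorem norm_map_mul_sub_le (hφ : φ 1 = 1) (a b : 𝔄) :
    ‖φ (a * b) - φ a * φ b‖ ≤ multDefect φ (star a) * multDefect φ b := by
  obtain ⟨K, _, _, _, X, -, hX, -⟩ := exists_adjoint_comp_eq_map_mul_sub hφ
  have h := hX (star a) b
  rw [StarHomClass.map_star φ, star_star, star_star] at h
  rw [← h, ← norm_eq_multDefect hX, ← norm_eq_multDefect hX,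
    ← LinearIsometryEquiv.norm_map ContinuousLinearMap.adjoint (X (star a))]
  exact ContinuousLinearMap.opNorm_comp_le _ _

end MultDefect

section IntervalIntegral

theorem tendsto_inv_mul_integral {g : ℝ → ℂ} (hg : Continuous g) (a : ℝ) :
    Tendsto (fun τ : ℝ≥0 => ((τ : ℝ) : ℂ)⁻¹ * ∫ s in a..(a + τ), g s) (𝓝[>] 0) (𝓝 (g a)) := by
  have hderiv : HasDerivWithinAt (fun u => ∫ s in a..u, g s) (g a) (Set.Ioi a) a :=
    (hg.integral_hasStrictDerivAt a a).hasDerivAt.hasDerivWithinAt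
  rw [hasDerivWithinAt_iff_tendsto_slope' (by simp)] at hderiv
  have hshift : Tendsto (fun τ : ℝ≥0 => a + (τ : ℝ)) (𝓝[>] 0) (𝓝[>] a) := by
    refine tendsto_nhdsWithin_of_tendsto_nhds_of_eventually_within _ ?_ ?_
    · have hcont : Continuous fun τ : ℝ≥0 => a + (τ : ℝ) := by fun_prop
      simpa using (hcont.tendsto 0).mono_left nhdsWithin_le_nhds
    · filter_upwards [self_mem_nhdsWithin] with τ hτ
      simpa using hτ
  exact (hderiv.comp hshift).congr fun τ => by simp [slope_def_module]

/-- Unlike the monotone convergence theorem, Dini's theorem applies to nets. -/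
theorem tendsto_intervalIntegral_of_antitone {ι : Type*} [Preorder ι] {F : ι → ℝ → ℝ} {a b : ℝ}
    (hF : ∀ i, Continuous (F i)) (hanti : ∀ s, Antitone (F · s))
    (hlim : ∀ s, Tendsto (F · s) atTop (𝓝 0)) :
    Tendsto (fun i => ∫ s in a..b, F i s) atTop (𝓝 0) := by
  have hunif : TendstoUniformlyOn F 0 atTop (Set.uIcc a b) :=
    Antitone.tendstoUniformlyOn_of_forall_tendsto isCompact_uIcc (fun i => (hF i).continuousOn)
      (fun s _ => hanti s) continuousOn_const fun s _ => hlim s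
  refine Metric.tendsto_nhds.2 fun ε hε => ?_
  have hpos : 0 < |b - a| + 1 := by positivity
  filter_upwards [Metric.tendstoUniformlyOn_iff.1 hunif _ (div_pos hε hpos)] with i hi
  have hle : ‖∫ s in a..b, F i s‖ ≤ ε / (|b - a| + 1) * |b - a| :=
    intervalIntegral.norm_integral_le_of_norm_le_const fun s hs => by
      simpa [dist_eq_norm] using (hi s (Set.uIoc_subset_uIcc hs)).le
  rw [dist_zero_right]
  refine hle.trans_lt ?_
  rw [div_mul_eq_mul_div, div_lt_iff₀ hpos]
  linarith

end IntervalIntegral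

namespace QuantumMarkovSemigroup

open MeasureTheory ComplexOrder

variable {H : Type u} [NormedAddCommGroup H] [InnerProductSpace ℂ H] [CompleteSpace H]
  (S : QuantumMarkovSemigroup H) {A A' B B' : H →L[ℂ] H}

theorem map_star (t : ℝ≥0) (A : H →L[ℂ] H) : S.toFun t (star A) = star (S.toFun t A) :=
  StarHomClass.map_star (S.toFun t) A

theorem norm_map_le (t : ℝ≥0) (A : H →L[ℂ] H) : ‖S.toFun t A‖ ≤ ‖A‖ :=
  norm_map_le_of_map_one (S.map_one t) A

theorem continuous_inner (A : H →L[ℂ] H) (x y : H) :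
    Continuous fun s : ℝ => ⟪x, S.toFun s.toNNReal A y⟫_ℂ := by
  have horbit (s : ℝ≥0) : SigmaWeakTendsto (fun s => S.toFun s A) (𝓝 s) (S.toFun s A) :=
    @Continuous.tendsto _ _ _ (sigmaWeak H) _ (S.orbit_continuous A) s
  exact (continuous_iff_continuousAt.2 fun s => (horbit s).inner x y).comp continuous_real_toNNReal

theorem sigmaWeakTendsto_map {ι : Type*} {l : Filter ι} {f : ι → H →L[ℂ] H}
    (hf : SigmaWeakTendsto f l B) (t : ℝ≥0) :
    SigmaWeakTendsto (fun i => S.toFun t (f i)) l (S.toFun t B) :=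
  (@Continuous.tendsto _ _ (sigmaWeak H) (sigmaWeak H) _ (S.sigmaWeak_continuous t) B).comp hf

variable {S}

theorem IsDerivAtZero.hasDerivWithinAt (h : S.IsDerivAtZero A B) (x y : H) {s : ℝ} (hs : 0 ≤ s) :
    HasDerivWithinAt (fun r : ℝ => ⟪x, S.toFun r.toNNReal A y⟫_ℂ)
      ⟪x, S.toFun s.toNNReal B y⟫_ℂ (Set.Ioi s) s := by
  rw [hasDerivWithinAt_iff_tendsto_slope' (by simp)]
  have hshift : Tendsto (fun r : ℝ => (r - s).toNNReal) (𝓝[>] s) (𝓝[>] 0) := by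
    refine tendsto_nhdsWithin_of_tendsto_nhds_of_eventually_within _ ?_ ?_
    · have hcont : Continuous fun r : ℝ => (r - s).toNNReal := by fun_prop
      simpa using (hcont.tendsto s).mono_left nhdsWithin_le_nhds
    · filter_upwards [self_mem_nhdsWithin] with r hr
      simpa using hr
  refine (((S.sigmaWeakTendsto_map h s.toNNReal).inner x y).comp hshift).congr' ?_
  filter_upwards [self_mem_nhdsWithin] with r (hr : s < r)
  have hadd : r.toNNReal = s.toNNReal + (r - s).toNNReal := by
    rw [← Real.toNNReal_add hs (sub_nonneg.2 hr.le), add_sub_cancel]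
  simp only [Function.comp_apply, slope_def_module, hadd, S.map_add, map_smul, map_sub,
    _root_.smul_apply, _root_.sub_apply, inner_smul_right, inner_sub_right,
    Real.coe_toNNReal _ (sub_nonneg.2 hr.le), Complex.real_smul, Complex.ofReal_inv]

theorem IsDerivAtZero.inner_sub_eq_integral (h : S.IsDerivAtZero A B) (x y : H) (t : ℝ≥0) :
    ⟪x, (S.toFun t A - A) y⟫_ℂ = ∫ s in (0 : ℝ)..t, ⟪x, S.toFun s.toNNReal B y⟫_ℂ := by
  rw [intervalIntegral.integral_eq_sub_of_hasDeriv_right_of_le t.coe_nonneg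
    (S.continuous_inner A x y).continuousOn (fun s hs => h.hasDerivWithinAt x y hs.1.le)
    ((S.continuous_inner B x y).intervalIntegrable _ _)]
  simp [S.map_zero]

theorem IsDerivAtZero.norm_sub_le (h : S.IsDerivAtZero A B) (t : ℝ≥0) :
    ‖S.toFun t A - A‖ ≤ ‖B‖ * t := by
  refine ContinuousLinearMap.opNorm_le_of_re_inner_le (by positivity) fun y x hy hx => ?_
  rw [inner_re_symm, h.inner_sub_eq_integral]
  refine (Complex.re_le_norm _).trans <|
    (intervalIntegral.norm_integral_le_of_norm_le_const (C := ‖B‖) fun s _ => ?_).trans_eq ?_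
  · calc ‖⟪x, S.toFun s.toNNReal B y⟫_ℂ‖ ≤ ‖x‖ * (‖B‖ * ‖y‖) := (norm_inner_le_norm _ _).trans
          (by gcongr; exact (S.toFun _ B).le_of_opNorm_le (S.norm_map_le _ B) y)
      _ = ‖B‖ := by rw [hx, hy, one_mul, mul_one]
  · rw [sub_zero, abs_of_nonneg t.coe_nonneg]

variable (S) in
/-- The functional `X ↦ ∫₀ᵗ ⟨x, T_s X x⟩ ds`, which expresses `T_t A - A` through the generator. -/
noncomputable def integralFunctional (x : H) (t : ℝ≥0) : (H →L[ℂ] H) →ₚ[ℂ] ℂ :=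
  PositiveLinearMap.mk₀
    { toFun := fun A => ∫ s in (0 : ℝ)..t, ⟪x, S.toFun s.toNNReal A x⟫_ℂ
      map_add' := fun A B => by
        rw [← intervalIntegral.integral_add ((S.continuous_inner A x x).intervalIntegrable _ _)
          ((S.continuous_inner B x x).intervalIntegrable _ _)]
        simp
      map_smul' := fun c A => by simp }
    fun A hA => by
      change 0 ≤ ∫ s in (0 : ℝ)..t, ⟪x, S.toFun s.toNNReal A x⟫_ℂ
      rw [intervalIntegral.integral_of_le t.coe_nonneg]
      exact integral_nonneg fun s => ((ContinuousLinearMap.nonneg_iff_isPositive _).1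
        (map_nonneg (S.toFun s.toNNReal) hA)).inner_nonneg_right x

theorem integralFunctional_apply (x : H) (t : ℝ≥0) (A : H →L[ℂ] H) :
    S.integralFunctional x t A = ∫ s in (0 : ℝ)..t, ⟪x, S.toFun s.toNNReal A x⟫_ℂ := rfl

theorem tendsto_integralFunctional_one_sub_basisProj {ι : Type*} (e : HilbertBasis ι ℂ H) (x : H)
    (t : ℝ≥0) :
    Tendsto (fun F => S.integralFunctional x t (1 - basisProj e F)) atTop (𝓝 0) := by
  let g (F : Finset ι) (s : ℝ) : ℂ := ⟪x, S.toFun s.toNNReal (1 - basisProj e F) x⟫_ℂ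
  have hreal (F : Finset ι) (s : ℝ) : g F s = (g F s).re := by
    have hpos := map_nonneg (S.toFun s.toNNReal) (isStarProjection_basisProj e F).one_sub.nonneg
    rw [ContinuousLinearMap.nonneg_iff_isPositive] at hpos
    exact Complex.eq_re_of_ofReal_le (hpos.inner_nonneg_right x)
  have hanti (s : ℝ) : Antitone fun F => (g F s).re := fun F G hFG => by
    have hmono : S.toFun s.toNNReal (1 - basisProj e G) ≤ S.toFun s.toNNReal (1 - basisProj e F) :=
      OrderHomClass.mono _ (sub_le_sub_left (monotone_basisProj e hFG) 1)
    have hpos := (Complex.le_def.1 ((ContinuousLinearMap.le_def _ _).1 hmono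
      |>.inner_nonneg_right x)).1
    rw [_root_.sub_apply, inner_sub_right, Complex.sub_re] at hpos
    exact sub_nonneg.1 hpos
  have hlim (s : ℝ) : Tendsto (fun F => (g F s).re) atTop (𝓝 0) := by
    have hweak : Tendsto (fun F => ⟪x, S.toFun s.toNNReal (1 * basisProj e F) x⟫_ℂ) atTop
        (𝓝 ⟪x, S.toFun s.toNNReal 1 x⟫_ℂ) :=
      (S.sigmaWeakTendsto_map (sigmaWeakTendsto_mul_basisProj e 1) _).inner x x
    simpa [g, inner_sub_right, Function.comp_def] using
      (Complex.continuous_re.tendsto _).comp (hweak.const_sub ⟪x, S.toFun s.toNNReal 1 x⟫_ℂ)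
  have hint := tendsto_intervalIntegral_of_antitone (a := 0) (b := t)
    (fun F => Complex.continuous_re.comp (S.continuous_inner _ x x)) hanti hlim
  have hofReal (F : Finset ι) :
      S.integralFunctional x t (1 - basisProj e F) = ∫ s in (0 : ℝ)..t, (g F s).re := by
    rw [integralFunctional_apply, ← intervalIntegral.integral_ofReal]
    exact intervalIntegral.integral_congr fun s _ => hreal F s
  simpa only [hofReal, Function.comp_def, Complex.ofReal_zero] using
    (Complex.continuous_ofReal.tendsto _).comp hint

theorem tendsto_integralFunctional {ι : Type*} {l : Filter ι} {f : ι → H →L[ℂ] H}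
    (hf : SigmaWeakTendsto f l B) (x : H) (t : ℝ≥0) :
    Tendsto (fun i => S.integralFunctional x t (f i)) l (𝓝 (S.integralFunctional x t B)) := by
  obtain ⟨_, e, -⟩ := exists_hilbertBasis ℂ H
  obtain ⟨w, hw, hwt⟩ :=
    exists_eq_tsum_inner e (tendsto_integralFunctional_one_sub_basisProj (S := S) e x t)
  simpa only [hwt] using sigmaWeakTendsto_iff.1 hf w w hw hw

theorem tendsto_inv_mul_integralFunctional (x : H) (B : H →L[ℂ] H) :
    Tendsto (fun τ : ℝ≥0 => ((τ : ℝ) : ℂ)⁻¹ * S.integralFunctional x τ B) (𝓝[>] 0)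
      (𝓝 ⟪x, B x⟫_ℂ) := by
  simpa [integralFunctional_apply, S.map_zero] using
    tendsto_inv_mul_integral (S.continuous_inner B x x) 0

theorem integralFunctional_map (A : H →L[ℂ] H) (x : H) (t τ : ℝ≥0) :
    S.integralFunctional x t (S.toFun τ A)
      = ∫ s in (τ : ℝ)..(t + τ), ⟪x, S.toFun s.toNNReal A x⟫_ℂ := by
  rw [integralFunctional_apply]
  have hshift := intervalIntegral.integral_comp_add_right (a := 0) (b := t)
    (fun s : ℝ => ⟪x, S.toFun s.toNNReal A x⟫_ℂ) (τ : ℝ)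
  rw [zero_add] at hshift
  rw [← hshift]
  refine intervalIntegral.integral_congr fun s hs => ?_
  rw [Set.uIcc_of_le t.coe_nonneg] at hs
  simp only [Real.toNNReal_add hs.1 τ.coe_nonneg, S.map_add, Real.toNNReal_coe]

theorem tendsto_integralFunctional_inv_smul (A : H →L[ℂ] H) (x : H) (t : ℝ≥0) :
    Tendsto (fun τ : ℝ≥0 => S.integralFunctional x t (((τ : ℝ) : ℂ)⁻¹ • (S.toFun τ A - A)))
      (𝓝[>] 0) (𝓝 ⟪x, (S.toFun t A - A) x⟫_ℂ) := by
  have hg := S.continuous_inner A x x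
  have hint (a b : ℝ) := hg.intervalIntegrable (μ := volume) a b
  have hends := (tendsto_inv_mul_integral hg t).sub (tendsto_inv_mul_integral hg 0)
  rw [Real.toNNReal_coe, Real.toNNReal_zero, S.map_zero, ← inner_sub_right] at hends
  refine hends.congr fun τ => ?_
  rw [← mul_sub, _root_.map_smul, _root_.map_sub, smul_eq_mul, integralFunctional_map,
    integralFunctional_apply, zero_add,
    intervalIntegral.integral_interval_sub_interval_comm' (hint _ _) (hint _ _) (hint _ _)]

end QuantumMarkovSemigroup

theorem sum_inner_star_mul_eq_norm_sq {ι H : Type*} [NormedAddCommGroup H] [InnerProductSpace ℂ H]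
    [CompleteSpace H] (s : Finset ι) (b : ι → H →L[ℂ] H) (x : ι → H) :
    ∑ i ∈ s, ∑ j ∈ s, ⟪x i, (star (b i) * b j) (x j)⟫_ℂ = (‖∑ i ∈ s, b i (x i)‖ : ℂ) ^ 2 := by
  simp only [mul_apply_eq_comp, ContinuousLinearMap.star_eq_adjoint,
    ContinuousLinearMap.adjoint_inner_right, ← inner_sum, ← sum_inner]
  exact inner_self_eq_norm_sq_to_K _

namespace QuantumMarkovSemigroup

section Generator

variable {H : Type u} [NormedAddCommGroup H] [InnerProductSpace ℂ H] [CompleteSpace H]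
  {S : QuantumMarkovSemigroup H} {A A' B B' : H →L[ℂ] H}

theorem eq_zero_of_isDerivAtZero {ι : Type*} {l : Filter ι} [l.NeBot] {f g : ι → H →L[ℂ] H}
    (h : ∀ i, S.IsDerivAtZero (f i) (g i)) (hf : SigmaWeakTendsto f l 0)
    (hg : SigmaWeakTendsto g l B) : B = 0 := by
  have hzero (x : H) (t : ℝ≥0) : S.integralFunctional x t B = 0 := by
    refine tendsto_nhds_unique (tendsto_integralFunctional hg x t) ?_
    simp only [integralFunctional_apply, ← (h _).inner_sub_eq_integral]
    simpa [inner_sub_right] using ((S.sigmaWeakTendsto_map hf t).inner x x).sub (hf.inner x x)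
  refine ext_inner_self fun x => ?_
  have hlim := tendsto_inv_mul_integralFunctional (S := S) x B
  simp only [hzero, mul_zero] at hlim
  simpa using tendsto_nhds_unique hlim tendsto_const_nhds

theorem eventually_norm_inv_smul_le {C : ℝ} (hC : ∀ t, ‖S.toFun t A - A‖ ≤ C * t) :
    ∀ᶠ t : ℝ≥0 in 𝓝[>] 0, ‖((t : ℝ) : ℂ)⁻¹ • (S.toFun t A - A)‖ ≤ C := by
  filter_upwards [self_mem_nhdsWithin] with t ht
  have ht_pos : 0 < (t : ℝ) := ht
  rw [norm_smul, norm_inv, Complex.norm_real, Real.norm_of_nonneg ht_pos.le,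
    inv_mul_le_iff₀ ht_pos, mul_comm]
  exact hC t

/-- The difference quotients are bounded, so they have a cluster point; the integral formula shows
that it is their limit. -/
theorem mem_domain_of_norm_sub_le {C : ℝ} (hC : ∀ t, ‖S.toFun t A - A‖ ≤ C * t) :
    A ∈ S.domain := by
  have hbdd := eventually_norm_inv_smul_le hC
  let l := Ultrafilter.of (𝓝[>] (0 : ℝ≥0))
  have hl : (l : Filter ℝ≥0) ≤ 𝓝[>] 0 := Ultrafilter.of_le _
  obtain ⟨B, hB⟩ := exists_tendsto_inner_of_opNorm_le l (hbdd.filter_mono hl)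
  have hB_weak := sigmaWeakTendsto_of_bounded (hbdd.filter_mono hl) fun x => hB x x
  have hintegral (x : H) (t : ℝ≥0) : S.integralFunctional x t B = ⟪x, (S.toFun t A - A) x⟫_ℂ :=
    tendsto_nhds_unique (tendsto_integralFunctional hB_weak x t)
      ((tendsto_integralFunctional_inv_smul A x t).mono_left hl)
  refine ⟨B, sigmaWeakTendsto_of_bounded hbdd fun x => ?_⟩
  simpa only [hintegral, _root_.smul_apply, inner_smul_right] using
    tendsto_inv_mul_integralFunctional (S := S) x B

theorem IsDerivAtZero.generator_eq (h : S.IsDerivAtZero A B) : S.generator A = B := by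
  have hex : ∃ B, S.IsDerivAtZero A B := ⟨B, h⟩
  rw [generator, dif_pos hex]
  exact SigmaWeakTendsto.unique hex.choose_spec h

theorem isDerivAtZero_generator (h : A ∈ S.domain) : S.IsDerivAtZero A (S.generator A) := by
  obtain ⟨B, hB⟩ := h
  rwa [hB.generator_eq]

theorem IsDerivAtZero.add (h : S.IsDerivAtZero A B) (h' : S.IsDerivAtZero A' B') :
    S.IsDerivAtZero (A + A') (B + B') := by
  refine (SigmaWeakTendsto.add h h').congr fun t => ?_
  rw [_root_.map_add, ← smul_add, add_sub_add_comm]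

theorem IsDerivAtZero.smul (c : ℂ) (h : S.IsDerivAtZero A B) :
    S.IsDerivAtZero (c • A) (c • B) := by
  have hc := SigmaWeakTendsto.sandwich h (c • ContinuousLinearMap.id ℂ H) (.id ℂ H)
  simp only [ContinuousLinearMap.smul_comp, ContinuousLinearMap.id_comp,
    ContinuousLinearMap.comp_id] at hc
  refine hc.congr fun t => ?_
  rw [_root_.map_smul, ← smul_sub, smul_comm]

theorem IsDerivAtZero.star (h : S.IsDerivAtZero A B) : S.IsDerivAtZero (star A) (star B) := by
  have hquot (t : ℝ≥0) : ((t : ℝ) : ℂ)⁻¹ • (S.toFun t (Star.star A) - Star.star A)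
      = Star.star (((t : ℝ) : ℂ)⁻¹ • (S.toFun t A - A)) := by
    simp [S.map_star]
  have hadjoint (A : H →L[ℂ] H) (x : H) : ⟪x, Star.star A x⟫_ℂ = starRingEnd ℂ ⟪x, A x⟫_ℂ := by
    rw [ContinuousLinearMap.star_eq_adjoint, ContinuousLinearMap.adjoint_inner_right,
      inner_conj_symm]
  refine sigmaWeakTendsto_of_bounded (C := ‖B‖) ?_ fun x => ?_
  · simpa only [hquot, norm_star] using eventually_norm_inv_smul_le h.norm_sub_le
  · simpa only [hquot, hadjoint, Function.comp_def] using
      (Complex.continuous_conj.tendsto _).comp (SigmaWeakTendsto.inner h x x)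

theorem isDerivAtZero_one : S.IsDerivAtZero 1 0 := by
  refine sigmaWeakTendsto_of_bounded (C := 0) (.of_forall fun t => ?_) fun x => ?_ <;>
    simp [S.map_one]

theorem generator_add (hA : A ∈ S.domain) (hB : B ∈ S.domain) :
    S.generator (A + B) = S.generator A + S.generator B :=
  ((isDerivAtZero_generator hA).add (isDerivAtZero_generator hB)).generator_eq

theorem generator_smul (c : ℂ) (hA : A ∈ S.domain) : S.generator (c • A) = c • S.generator A :=
  ((isDerivAtZero_generator hA).smul c).generator_eq

theorem generator_neg (hA : A ∈ S.domain) : S.generator (-A) = -S.generator A := by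
  rw [← neg_one_smul ℂ A, generator_smul _ hA, neg_one_smul]

theorem generator_star (hA : A ∈ S.domain) : S.generator (star A) = star (S.generator A) :=
  (isDerivAtZero_generator hA).star.generator_eq

theorem add_mem_domain (hA : A ∈ S.domain) (hB : B ∈ S.domain) : A + B ∈ S.domain :=
  ⟨_, (isDerivAtZero_generator hA).add (isDerivAtZero_generator hB)⟩

theorem smul_mem_domain (c : ℂ) (hA : A ∈ S.domain) : c • A ∈ S.domain :=
  ⟨_, (isDerivAtZero_generator hA).smul c⟩

theorem neg_mem_domain (hA : A ∈ S.domain) : -A ∈ S.domain := by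
  rw [← neg_one_smul ℂ A]
  exact smul_mem_domain _ hA

theorem star_mem_domain (hA : A ∈ S.domain) : star A ∈ S.domain :=
  ⟨_, (isDerivAtZero_generator hA).star⟩

theorem algebraMap_mem_domain (c : ℂ) : algebraMap ℂ (H →L[ℂ] H) c ∈ S.domain := by
  rw [Algebra.algebraMap_eq_smul_one]
  exact smul_mem_domain c ⟨0, isDerivAtZero_one⟩

/-- Conditional complete positivity of the generator. -/
theorem re_sum_inner_generator_nonneg {ι : Type*} (s : Finset ι) (b : ι → H →L[ℂ] H) (x : ι → H)
    (hb : ∀ i j, star (b i) * b j ∈ S.domain) (hx : ∑ i ∈ s, b i (x i) = 0) :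
    0 ≤ (∑ i ∈ s, ∑ j ∈ s, ⟪x i, S.generator (star (b i) * b j) (x j)⟫_ℂ).re := by
  have hlim : Tendsto (fun t : ℝ≥0 => (∑ i ∈ s, ∑ j ∈ s, ⟪x i, (((t : ℝ) : ℂ)⁻¹ •
      (S.toFun t (star (b i) * b j) - star (b i) * b j)) (x j)⟫_ℂ).re) (𝓝[>] 0)
      (𝓝 (∑ i ∈ s, ∑ j ∈ s, ⟪x i, S.generator (star (b i) * b j) (x j)⟫_ℂ).re) :=
    (Complex.continuous_re.tendsto _).comp (tendsto_finsetSum _ fun i _ =>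
      tendsto_finsetSum _ fun j _ => SigmaWeakTendsto.inner (isDerivAtZero_generator (hb i j)) _ _)
  refine ge_of_tendsto hlim (.of_forall fun t => ?_)
  have hvanish := sum_inner_star_mul_eq_norm_sq s b x
  rw [hx, norm_zero, Complex.ofReal_zero, zero_pow two_ne_zero] at hvanish
  simp only [_root_.smul_apply, _root_.sub_apply, inner_smul_right, inner_sub_right,
    ← Finset.mul_sum, Finset.sum_sub_distrib, hvanish, sub_zero]
  rw [← Complex.ofReal_inv, Complex.re_ofReal_mul]
  exact mul_nonneg (inv_nonneg.2 t.coe_nonneg)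
    (re_sum_inner_map_star_mul_nonneg (S.toFun t) s b x)

end Generator

section DomainAlgebra

variable {H : Type u} [NormedAddCommGroup H] [InnerProductSpace ℂ H] [CompleteSpace H]
  {S : QuantumMarkovSemigroup H} {A A' B B' : H →L[ℂ] H}

variable (S) in
/-- The semigroup is multiplicative at `A` up to an error that is linear in time; the square root
comes from the one in the definition of `multDefect`. -/
def HasLinearDefect (A : H →L[ℂ] H) : Prop :=
  ∃ C : ℝ, ∀ t : ℝ≥0, multDefect (S.toFun t) A ≤ C * √t

theorem HasLinearDefect.add (hA : S.HasLinearDefect A) (hB : S.HasLinearDefect B) :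
    S.HasLinearDefect (A + B) := by
  obtain ⟨C, hC⟩ := hA
  obtain ⟨C', hC'⟩ := hB
  refine ⟨C + C', fun t => (multDefect_add_le (S.map_one t) A B).trans ?_⟩
  rw [add_mul]
  exact add_le_add (hC t) (hC' t)

theorem HasLinearDefect.mul (hA : S.HasLinearDefect A) (hB : S.HasLinearDefect B) :
    S.HasLinearDefect (A * B) := by
  obtain ⟨C, hC⟩ := hA
  obtain ⟨C', hC'⟩ := hB
  refine ⟨‖A‖ * C' + C * ‖B‖, fun t => (multDefect_mul_le (S.map_one t) A B).trans ?_⟩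
  calc _ ≤ ‖A‖ * (C' * √t) + C * √t * ‖B‖ := by gcongr; exacts [hC' t, hC t]
    _ = (‖A‖ * C' + C * ‖B‖) * √t := by ring

theorem norm_map_mul_map_sub_le (hA : S.IsDerivAtZero A A') (hB : S.IsDerivAtZero B B')
    (t : ℝ≥0) : ‖S.toFun t A * S.toFun t B - A * B‖ ≤ (‖A'‖ * ‖B‖ + ‖A‖ * ‖B'‖) * t := by
  have hleibniz : S.toFun t A * S.toFun t B - A * B
      = (S.toFun t A - A) * S.toFun t B + A * (S.toFun t B - B) := by noncomm_ring
  calc _ ≤ ‖S.toFun t A - A‖ * ‖S.toFun t B‖ + ‖A‖ * ‖S.toFun t B - B‖ := by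
        rw [hleibniz]
        exact (norm_add_le _ _).trans (add_le_add (norm_mul_le _ _) (norm_mul_le _ _))
    _ ≤ (‖A'‖ * t) * ‖B‖ + ‖A‖ * (‖B'‖ * t) := by
        gcongr
        exacts [hA.norm_sub_le t, S.norm_map_le t B, hB.norm_sub_le t]
    _ = _ := by ring

theorem hasLinearDefect_of_mem_domain (hA : A ∈ S.domain) (hAA : star A * A ∈ S.domain) :
    S.HasLinearDefect A := by
  obtain ⟨A', hA'⟩ := hA
  obtain ⟨B', hB'⟩ := hAA
  refine ⟨√(‖B'‖ + (‖star A'‖ * ‖A‖ + ‖star A‖ * ‖A'‖)), fun t => ?_⟩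
  have hsplit : S.toFun t (star A * A) - star (S.toFun t A) * S.toFun t A
      = (S.toFun t (star A * A) - star A * A)
        - (S.toFun t (star A) * S.toFun t A - star A * A) := by
    rw [S.map_star, sub_sub_sub_cancel_right]
  rw [multDefect, ← Real.sqrt_mul (by positivity), hsplit, add_mul]
  exact Real.sqrt_le_sqrt <| (norm_sub_le _ _).trans <|
    add_le_add (hB'.norm_sub_le t) (norm_map_mul_map_sub_le hA'.star hA' t)

/-- `‖T_t(AB) - T_t(A) T_t(B)‖` is bounded by a product of two defects, hence linearly in `t`. -/
theorem mul_mem_domain (hA : A ∈ S.domain) (hB : B ∈ S.domain)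
    (hA_defect : S.HasLinearDefect (star A)) (hB_defect : S.HasLinearDefect B) :
    A * B ∈ S.domain := by
  obtain ⟨A', hA'⟩ := hA
  obtain ⟨B', hB'⟩ := hB
  obtain ⟨C, hC⟩ := hA_defect
  obtain ⟨C', hC'⟩ := hB_defect
  refine mem_domain_of_norm_sub_le (C := C * C' + (‖A'‖ * ‖B‖ + ‖A‖ * ‖B'‖)) fun t => ?_
  have hdefect : ‖S.toFun t (A * B) - S.toFun t A * S.toFun t B‖ ≤ C * C' * t :=
    calc _ ≤ multDefect (S.toFun t) (star A) * multDefect (S.toFun t) B :=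
          norm_map_mul_sub_le (S.map_one t) A B
      _ ≤ (C * √t) * (C' * √t) :=
          mul_le_mul (hC t) (hC' t) (Real.sqrt_nonneg _) ((Real.sqrt_nonneg _).trans (hC t))
      _ = C * C' * t := by rw [mul_mul_mul_comm, Real.mul_self_sqrt t.coe_nonneg]
  rw [add_mul]
  exact (norm_sub_le_norm_sub_add_norm_sub _ _ _).trans
    (add_le_add hdefect (norm_map_mul_map_sub_le hA' hB' t))

theorem hasLinearDefect_algebraMap (c : ℂ) : S.HasLinearDefect (algebraMap ℂ (H →L[ℂ] H) c) :=
  hasLinearDefect_of_mem_domain (algebraMap_mem_domain c) (by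
    rw [← algebraMap_star_comm, ← _root_.map_mul]
    exact algebraMap_mem_domain _)

variable (S) in
/-- The operators in the domain of the generator at which the semigroup is multiplicative up to a
linear error. It is a `*`-algebra that contains every `*`-algebra inside the domain. -/
noncomputable def linearDefectAlgebra : StarSubalgebra ℂ (H →L[ℂ] H) where
  carrier := {A | A ∈ S.domain ∧ S.HasLinearDefect A ∧ S.HasLinearDefect (star A)}
  mul_mem' hA hB :=
    ⟨mul_mem_domain hA.1 hB.1 hA.2.2 hB.2.1, hA.2.1.mul hB.2.1, by
      rw [star_mul]; exact hB.2.2.mul hA.2.2⟩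
  add_mem' hA hB :=
    ⟨add_mem_domain hA.1 hB.1, hA.2.1.add hB.2.1, by rw [star_add]; exact hA.2.2.add hB.2.2⟩
  algebraMap_mem' c :=
    ⟨algebraMap_mem_domain c, hasLinearDefect_algebraMap c, by
      rw [← algebraMap_star_comm]; exact hasLinearDefect_algebraMap _⟩
  star_mem' hA := ⟨star_mem_domain hA.1, hA.2.2, by rw [star_star]; exact hA.2.1⟩

theorem domainAlgebra_le_linearDefectAlgebra : S.domainAlgebra ≤ S.linearDefectAlgebra := by
  refine sSup_le fun M hM => ?_
  have hdefect {B : H →L[ℂ] H} (hB : B ∈ M) : S.HasLinearDefect B :=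
    hasLinearDefect_of_mem_domain (hM hB) (hM (mul_mem (star_mem hB) hB))
  exact fun B hB => ⟨hM hB, hdefect hB, hdefect (star_mem hB)⟩

theorem mem_domain_of_mem_domainAlgebra (hA : A ∈ S.domainAlgebra) : A ∈ S.domain :=
  (domainAlgebra_le_linearDefectAlgebra hA).1

end DomainAlgebra

end QuantumMarkovSemigroup

section AssociateVector

open InnerProductSpace

variable {H : Type*} [NormedAddCommGroup H] [InnerProductSpace ℂ H]

theorem inner_smul_sum_map_self {ι : Type*} [Fintype ι] {k : ι → H} (hk : Orthonormal ℂ k)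
    (t : ι → ℝ) (a : ℝ) :
    ⟪(a : ℂ) • ∑ s, k s, (∑ s, (t s : ℂ) • rankOne ℂ (k s) (k s)) ((a : ℂ) • ∑ s, k s)⟫_ℂ
      = ((a ^ 2 * ∑ s, t s : ℝ) : ℂ) := by
  have hright (s : ι) : ⟪k s, ∑ r, k r⟫_ℂ = 1 := by
    simpa only [one_smul] using hk.inner_right_fintype (fun _ => 1) s
  have hleft (s : ι) : ⟪∑ r, k r, k s⟫_ℂ = 1 := by
    rw [← inner_conj_symm, hright, map_one]
  simp only [map_smul, _root_.sum_apply, _root_.smul_apply, rankOne_apply, inner_smul_left,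
    inner_smul_right, inner_sum, hright, hleft, mul_one, Complex.conj_ofReal]
  rw [← Finset.sum_mul]
  push_cast
  ring

theorem IsAssociateVector.inner_map_self {T : H →L[ℂ] H} {h : H} (hh : IsAssociateVector T h)
    (hT : T ≠ 0) : ⟪h, T h⟫_ℂ = 1 := by
  obtain ⟨m, k', t', k, hk', ht', hTk, hk, hhk⟩ := hh
  have hm : Nonempty (Fin m) := by
    by_contra hm
    rw [not_nonempty_iff] at hm
    exact hT (by rw [hTk, Finset.univ_eq_empty, Finset.sum_empty])
  set t := ∑ r, t' r with ht
  have ht_pos : 0 < t := Finset.sum_pos (fun s _ => ht' s) Finset.univ_nonempty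
  have hk_norm (s : Fin m) : ‖k s‖ ^ 2 = t := by
    rw [hk, norm_smul, hk'.1 s, mul_one, Complex.norm_real,
      Real.norm_of_nonneg (Real.sqrt_nonneg _), Real.sq_sqrt ht_pos.le]
  have hh_eq : h = ((t⁻¹ * √t : ℝ) : ℂ) • ∑ s, k' s := by
    rw [hhk, Finset.smul_sum]
    refine Finset.sum_congr rfl fun s _ => ?_
    rw [← Complex.ofReal_pow, hk_norm, hk, smul_smul]
    push_cast
    rfl
  rw [hh_eq, hTk, inner_smul_sum_map_self hk', ← ht, mul_pow, Real.sq_sqrt ht_pos.le, inv_pow]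
  norm_cast
  field_simp

variable [CompleteSpace H]

/-- Write `T = D⋆D` and `e = D h`, a unit vector; then `b = (1 - |e⟩⟨e|) D = D - |e⟩⟨Th|`. -/
theorem exists_star_mul_self_eq_sub_rankOne {T : H →L[ℂ] H} (hT : T.IsPositive) {h : H}
    (hh : ⟪h, T h⟫_ℂ = 1) :
    ∃ b : H →L[ℂ] H, star b * b = T - rankOne ℂ (T h) (T h) ∧ b h = 0 := by
  obtain ⟨D, hD⟩ := CStarAlgebra.nonneg_iff_eq_star_mul_self.1
    ((ContinuousLinearMap.nonneg_iff_isPositive T).2 hT)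
  have hDe : D.adjoint (D h) = T h := by
    rw [hD, mul_apply_eq_comp, ContinuousLinearMap.star_eq_adjoint]
  have he : ⟪D h, D h⟫_ℂ = 1 := by
    rw [← ContinuousLinearMap.adjoint_inner_right, hDe, hh]
  have hTh : ⟪T h, h⟫_ℂ = 1 := by rw [← inner_conj_symm, hh, map_one]
  refine ⟨D - rankOne ℂ (D h) (T h), ?_, ?_⟩
  · ext x
    have hinner : ⟪D h, D x⟫_ℂ = ⟪T h, x⟫_ℂ := by
      rw [← hDe, ContinuousLinearMap.adjoint_inner_left]
    have hTx : T x = D.adjoint (D x) := by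
      rw [hD, mul_apply_eq_comp, ContinuousLinearMap.star_eq_adjoint]
    simp only [ContinuousLinearMap.star_eq_adjoint, map_sub, adjoint_rankOne, mul_apply_eq_comp,
      _root_.sub_apply, rankOne_apply, map_smul, hDe, he, hinner, hTx]
    simp
  · simp only [_root_.sub_apply, rankOne_apply, hTh, one_smul, sub_self]

end AssociateVector

namespace QuantumMarkovSemigroup

open InnerProductSpace

variable {H : Type u} [NormedAddCommGroup H] [InnerProductSpace ℂ H] [CompleteSpace H]
  {S : QuantumMarkovSemigroup H}

theorem re_inner_generator_rankOne_le {T : H →L[ℂ] H} (hT : T.IsPositive) (hT_dom : T ∈ S.domain)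
    {h : H} (hh : ⟪h, T h⟫_ℂ = 1) (hTh : rankOne ℂ (T h) (T h) ∈ S.domain) :
    (⟪h, S.generator (rankOne ℂ (T h) (T h)) h⟫_ℂ).re ≤ (⟪h, S.generator T h⟫_ℂ).re := by
  obtain ⟨b, hb, hbh⟩ := exists_star_mul_self_eq_sub_rankOne hT hh
  rw [sub_eq_add_neg] at hb
  have hcp := S.re_sum_inner_generator_nonneg {()} (fun _ => b) (fun _ => h)
    (fun _ _ => hb ▸ add_mem_domain hT_dom (neg_mem_domain hTh)) (by simp [hbh])
  simp only [Finset.sum_singleton, hb, generator_add hT_dom (neg_mem_domain hTh),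
    generator_neg hTh, _root_.add_apply, _root_.neg_apply, inner_add_right, inner_neg_right,
    Complex.add_re, Complex.neg_re] at hcp
  linarith

theorem ofReal_re_inner_generator {T : H →L[ℂ] H} (hT : IsSelfAdjoint T) (hT_dom : T ∈ S.domain)
    (h : H) : ((⟪h, S.generator T h⟫_ℂ).re : ℂ) = ⟪h, S.generator T h⟫_ℂ := by
  have hL : IsSelfAdjoint (S.generator T) := by
    rw [IsSelfAdjoint, ← generator_star hT_dom, hT.star_eq]
  exact hL.isSymmetric.coe_re_inner_self_apply h

variable (S) in
/-- The set `{x ∈ H : |x⟩⟨y| ∈ 𝒜}`, where `𝒜` is the domain algebra, as a subspace. -/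
noncomputable def rankOneSubmodule (y : H) : Submodule ℂ H where
  carrier := S.rankOneSpace y
  add_mem' {x x'} hx hx' := by
    change rankOne ℂ (x + x') y ∈ S.domainAlgebra
    rw [_root_.map_add, _root_.add_apply]
    exact add_mem hx hx'
  zero_mem' := by
    change rankOne ℂ (0 : H) y ∈ S.domainAlgebra
    rw [_root_.map_zero, _root_.zero_apply]
    exact zero_mem _
  smul_mem' c x hx := by
    change rankOne ℂ (c • x) y ∈ S.domainAlgebra
    rw [map_smul, _root_.smul_apply]
    exact SMulMemClass.smul_mem c hx

theorem map_mem_rankOneSubmodule {A : H →L[ℂ] H} (hA : A ∈ S.domainAlgebra) {x y : H}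
    (hx : x ∈ S.rankOneSubmodule y) : A x ∈ S.rankOneSubmodule y := by
  change rankOne ℂ (A x) y ∈ S.domainAlgebra
  rw [← comp_rankOne]
  exact mul_mem hA hx

theorem exists_apply_eq_generator_rankOne {y h : H} (hdense : Dense (S.rankOneSpace y))
    {C : ℝ} (hC : ∀ x ∈ S.rankOneSpace y, ‖S.generator (rankOne ℂ x y) h‖ ≤ C * ‖x‖) :
    ∃ F : H →L[ℂ] H, ∀ x ∈ S.rankOneSpace y, F x = S.generator (rankOne ℂ x y) h := by
  have hdom (x : S.rankOneSubmodule y) : rankOne ℂ (x : H) y ∈ S.domain :=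
    mem_domain_of_mem_domainAlgebra x.2
  let g : S.rankOneSubmodule y →ₗ[ℂ] H :=
    { toFun := fun x => S.generator (rankOne ℂ (x : H) y) h
      map_add' := fun x x' => by
        rw [Submodule.coe_add, _root_.map_add, _root_.add_apply,
          generator_add (hdom x) (hdom x'), _root_.add_apply]
      map_smul' := fun r x => by
        rw [Submodule.coe_smul, map_smul, _root_.smul_apply, generator_smul r (hdom x),
          _root_.smul_apply, RingHom.id_apply] }
  have hrange : DenseRange (S.rankOneSubmodule y).subtype := by
    change Dense (Set.range Subtype.val)
    rwa [Subtype.range_coe]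
  exact ⟨g.extendOfNorm (S.rankOneSubmodule y).subtype, fun x hx =>
    LinearMap.extendOfNorm_eq (f := g) hrange ⟨C, fun x => hC x x.2⟩ ⟨x, hx⟩⟩

/-- The family `b` is augmented by `-|z⟩⟨y|` acting on `h`, which turns the sum `z` into `0`, and
conditional complete positivity is applied to the augmented family. -/
theorem two_mul_re_sum_inner_generator_rankOne_le {ι : Type*} {s : Finset ι} {b : ι → H →L[ℂ] H}
    {x : ι → H} {y z h : H} (hz : ∑ i ∈ s, b i (x i) = z) (hyh : ⟪y, h⟫_ℂ = 1)
    (hb : ∀ i j, star (b i) * b j ∈ S.domain)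
    (hbz : ∀ i, rankOne ℂ (star (b i) z) y ∈ S.domain) (hy : rankOne ℂ y y ∈ S.domain) :
    2 * (∑ i ∈ s, ⟪x i, S.generator (rankOne ℂ (star (b i) z) y) h⟫_ℂ).re
      ≤ (∑ i ∈ s, ∑ j ∈ s, ⟪x i, S.generator (star (b i) * b j) (x j)⟫_ℂ).re
        + ‖z‖ ^ 2 * (⟪h, S.generator (rankOne ℂ y y) h⟫_ℂ).re := by
  let b' : Option ι → H →L[ℂ] H := fun o => o.elim (-rankOne ℂ z y) b
  let x' : Option ι → H := fun o => o.elim h x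
  have hnone : star (b' none) * b' none = ((‖z‖ ^ 2 : ℝ) : ℂ) • rankOne ℂ y y := by
    simp only [b', Option.elim_none, star_neg, neg_mul_neg, ContinuousLinearMap.star_eq_adjoint,
      adjoint_rankOne]
    rw [ContinuousLinearMap.mul_def, rankOne_comp_rankOne, inner_self_eq_norm_sq_to_K]
    norm_cast
  have hsome (i : ι) : star (b' (some i)) * b' none = -rankOne ℂ (star (b i) z) y := by
    simp only [b', Option.elim, mul_neg]
    exact congrArg _ (comp_rankOne _ _ _)
  have hstar (i : ι) : star (b' none) * b' (some i) = star (-rankOne ℂ (star (b i) z) y) := by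
    rw [← hsome, star_mul, star_star]
  have hdom : ∀ i j, star (b' i) * b' j ∈ S.domain := by
    rintro (_ | i) (_ | j)
    · exact hnone ▸ smul_mem_domain _ hy
    · exact hstar j ▸ star_mem_domain (neg_mem_domain (hbz j))
    · exact hsome i ▸ neg_mem_domain (hbz i)
    · exact hb i j
  have hzero : ∑ i ∈ s.insertNone, b' i (x' i) = 0 := by
    simp [Finset.sum_insertNone, b', x', hyh, hz]
  have hnonneg := S.re_sum_inner_generator_nonneg s.insertNone b' x' hdom hzero
  have hsymm (i : ι) : (⟪h, S.generator (star (-rankOne ℂ (star (b i) z) y)) (x i)⟫_ℂ).re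
      = -(⟪x i, S.generator (rankOne ℂ (star (b i) z) y) h⟫_ℂ).re := by
    rw [generator_star (neg_mem_domain (hbz i)), generator_neg (hbz i),
      ContinuousLinearMap.star_eq_adjoint, ContinuousLinearMap.adjoint_inner_right,
      _root_.neg_apply, inner_neg_left, Complex.neg_re]
    exact congrArg Neg.neg (inner_re_symm (𝕜 := ℂ) _ _)
  simp only [Finset.sum_insertNone, hnone, hsome, hstar, generator_smul _ hy,
    generator_neg (hbz _), Finset.sum_add_distrib, Complex.add_re, Complex.re_sum] at hnonneg
  simp only [b', x', Option.elim, hsymm, _root_.smul_apply, _root_.neg_apply, inner_smul_right,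
    inner_neg_right, Complex.neg_re, Complex.re_ofReal_mul, Finset.sum_neg_distrib] at hnonneg
  simp only [Complex.re_sum]
  linarith

variable (S) in
/-- The part `A ↦ L(A) - G A - A G⋆` of the generator on the domain algebra, to which Stinespring's
theorem is applied. -/
noncomputable def dissipation (G : H →L[ℂ] H) : S.domainAlgebra →ₗ[ℂ] (H →L[ℂ] H) where
  toFun A := S.generator A - G ∘L (A : H →L[ℂ] H) - (A : H →L[ℂ] H) ∘L G.adjoint
  map_add' A B := by
    rw [AddMemClass.coe_add, generator_add (mem_domain_of_mem_domainAlgebra A.2)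
      (mem_domain_of_mem_domainAlgebra B.2), ContinuousLinearMap.comp_add,
      ContinuousLinearMap.add_comp]
    abel
  map_smul' r A := by
    rw [SetLike.val_smul, generator_smul r (mem_domain_of_mem_domainAlgebra A.2),
      ContinuousLinearMap.comp_smul, ContinuousLinearMap.smul_comp, RingHom.id_apply,
      smul_sub, smul_sub]

theorem dissipation_apply (G : H →L[ℂ] H) (A : S.domainAlgebra) :
    S.dissipation G A
      = S.generator A - G ∘L (A : H →L[ℂ] H) - (A : H →L[ℂ] H) ∘L G.adjoint := rfl

theorem dissipation_star (G : H →L[ℂ] H) (A : S.domainAlgebra) :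
    S.dissipation G (star A) = star (S.dissipation G A) := by
  rw [dissipation_apply, dissipation_apply, StarMemClass.coe_star,
    generator_star (mem_domain_of_mem_domainAlgebra A.2)]
  simp only [star_sub, ContinuousLinearMap.star_eq_adjoint, ContinuousLinearMap.adjoint_comp,
    ContinuousLinearMap.adjoint_adjoint]
  abel

theorem re_sum_inner_dissipation {ι : Type*} {s : Finset ι} {b : ι → H →L[ℂ] H} {x : ι → H} {z : H}
    (hz : ∑ i ∈ s, b i (x i) = z) (hb : ∀ i j, star (b i) * b j ∈ S.domainAlgebra)
    (G : H →L[ℂ] H) :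
    (∑ i ∈ s, ∑ j ∈ s, ⟪x i, S.dissipation G ⟨star (b i) * b j, hb i j⟩ (x j)⟫_ℂ).re
      = (∑ i ∈ s, ∑ j ∈ s, ⟪x i, S.generator (star (b i) * b j) (x j)⟫_ℂ).re
        - 2 * (∑ i ∈ s, ⟪x i, G (star (b i) z)⟫_ℂ).re := by
  have hleft : ∑ i ∈ s, ∑ j ∈ s, ⟪x i, (G ∘L (star (b i) * b j)) (x j)⟫_ℂ
      = ∑ i ∈ s, ⟪x i, G (star (b i) z)⟫_ℂ := by
    simp only [← hz, map_sum, inner_sum, ContinuousLinearMap.comp_apply, mul_apply_eq_comp]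
  have hright : ∑ i ∈ s, ∑ j ∈ s, ⟪x i, ((star (b i) * b j) ∘L G.adjoint) (x j)⟫_ℂ
      = starRingEnd ℂ (∑ i ∈ s, ⟪x i, G (star (b i) z)⟫_ℂ) := by
    rw [← hleft, Finset.sum_comm, map_sum]
    refine Finset.sum_congr rfl fun j _ => ?_
    rw [map_sum]
    refine Finset.sum_congr rfl fun i _ => ?_
    rw [inner_conj_symm, ContinuousLinearMap.comp_apply, ContinuousLinearMap.comp_apply,
      ← ContinuousLinearMap.adjoint_inner_right G, ← ContinuousLinearMap.adjoint_inner_right,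
      ← ContinuousLinearMap.star_eq_adjoint (star (b j) * b i), star_mul, star_star]
  simp only [dissipation_apply, _root_.sub_apply, inner_sub_right, Finset.sum_sub_distrib, hleft,
    hright, Complex.sub_re, Complex.conj_re]
  ring

section Drift

variable {y h : H} {c : ℝ} {G : H →L[ℂ] H}

theorem re_sum_inner_dissipation_nonneg (hyh : ⟪y, h⟫_ℂ = 1) (hy : rankOne ℂ y y ∈ S.domain)
    (hc : (⟪h, S.generator (rankOne ℂ y y) h⟫_ℂ).re ≤ c)
    (hG : ∀ x ∈ S.rankOneSpace y, G x = S.generator (rankOne ℂ x y) h - ((1 / 2 : ℂ) * c) • x)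
    {ι : Type*} (s : Finset ι) (b : ι → H →L[ℂ] H)
    (hb : ∀ i j, star (b i) * b j ∈ S.domainAlgebra) (x : ι → H)
    (hx : ∀ i, x i ∈ S.rankOneSpace y) :
    0 ≤ (∑ i ∈ s, ∑ j ∈ s, ⟪x i, S.dissipation G ⟨star (b i) * b j, hb i j⟩ (x j)⟫_ℂ).re := by
  obtain ⟨z, hz⟩ : ∃ z, ∑ i ∈ s, b i (x i) = z := ⟨_, rfl⟩
  have hmem (i : ι) : star (b i) z ∈ S.rankOneSpace y := by
    rw [← hz, map_sum]
    exact Submodule.sum_mem (S.rankOneSubmodule y) fun j _ =>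
      map_mem_rankOneSubmodule (hb i j) (hx j)
  have hnorm : (∑ i ∈ s, ⟪x i, star (b i) z⟫_ℂ).re = ‖z‖ ^ 2 := by
    simp only [ContinuousLinearMap.star_eq_adjoint, ContinuousLinearMap.adjoint_inner_right,
      ← sum_inner, hz]
    exact inner_self_eq_norm_sq (𝕜 := ℂ) z
  have hdrift : 2 * (∑ i ∈ s, ⟪x i, G (star (b i) z)⟫_ℂ).re
      = 2 * (∑ i ∈ s, ⟪x i, S.generator (rankOne ℂ (star (b i) z) y) h⟫_ℂ).re - c * ‖z‖ ^ 2 := by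
    have hhalf : (1 / 2 : ℂ) * c = ((1 / 2 * c : ℝ) : ℂ) := by push_cast; rfl
    simp only [hG _ (hmem _), inner_sub_right, inner_smul_right, Finset.sum_sub_distrib,
      ← Finset.mul_sum, hhalf, Complex.sub_re, Complex.re_ofReal_mul, hnorm]
    ring
  have hle := two_mul_re_sum_inner_generator_rankOne_le hz hyh
    (fun i j => mem_domain_of_mem_domainAlgebra (hb i j))
    (fun i => mem_domain_of_mem_domainAlgebra (hmem i)) hy
  have hcz := mul_le_mul_of_nonneg_left hc (sq_nonneg ‖z‖)
  rw [re_sum_inner_dissipation hz hb]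
  linarith

theorem isCompletelyPositiveOn_dissipation (hyh : ⟪y, h⟫_ℂ = 1) (hy : rankOne ℂ y y ∈ S.domain)
    (hc : (⟪h, S.generator (rankOne ℂ y y) h⟫_ℂ).re ≤ c) (hdense : Dense (S.rankOneSpace y))
    (hG : ∀ x ∈ S.rankOneSpace y, G x = S.generator (rankOne ℂ x y) h - ((1 / 2 : ℂ) * c) • x) :
    IsCompletelyPositiveOn S.domainAlgebra (S.dissipation G) where
  map_star := dissipation_star G
  re_sum_inner_nonneg {ι} s b hb x := by
    have hdense_pi : Dense (Set.univ.pi fun _ : ι => S.rankOneSpace y) :=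
      dense_pi _ fun _ _ => hdense
    refine hdense_pi.induction (fun x hx => ?_) (isClosed_le continuous_const (by fun_prop)) x
    exact re_sum_inner_dissipation_nonneg hyh hy hc hG s b hb x fun i => hx i trivial

theorem exists_isMinimalStinespring {U : Set H} (hU : Dense U)
    (hG : IsCompletelyPositiveOn S.domainAlgebra (S.dissipation G)) :
    ∃ (K : Type u) (_ : NormedAddCommGroup K) (_ : InnerProductSpace ℂ K) (_ : CompleteSpace K)
      (V : H →L[ℂ] K) (π : S.domainAlgebra →⋆ₐ[ℂ] (K →L[ℂ] K)), S.IsMinimalStinespring U G V π := by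
  obtain ⟨K, _, _, _, V, π, hV, hπ, hspan⟩ := hG.exists_stinespring
  refine ⟨K, inferInstance, inferInstance, inferInstance, V, π, ?_, fun A => ?_, ?_⟩
  · exact AddMonoidHomClass.continuous_of_bound π 1 fun A => by simpa only [one_mul] using hπ A
  · rw [← hV, dissipation_apply]
    abel
  · have hle : Submodule.span ℂ {w : K | ∃ a x, w = π a (V x)}
        ≤ (Submodule.span ℂ {w : K | ∃ A : S.domainAlgebra, ∃ x ∈ U,
          w = π A (V x)}).topologicalClosure := by
      rw [Submodule.span_le]
      rintro _ ⟨A, x, rfl⟩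
      exact map_mem_closure (f := fun x => π A (V x)) (by fun_prop) (hU x) fun x hx =>
        Submodule.subset_span ⟨A, x, hx, rfl⟩
    rw [← dense_closure, ← Submodule.topologicalClosure_coe]
    exact hspan.mono hle

end Drift

/-- If `A → 0` and `π(A) → B`, then `V⋆ π(C)⋆ B π(D) V` is the `σ`-weak limit of `L(C⋆ A D)`. -/
theorem IsMinimalStinespring.isSigmaWeaklyClosable {U : Set H} {K : Type v} [NormedAddCommGroup K]
    [InnerProductSpace ℂ K] [CompleteSpace K] {G : H →L[ℂ] H} {V : H →L[ℂ] K}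
    {π : S.domainAlgebra →⋆ₐ[ℂ] (K →L[ℂ] K)} (hπ : S.IsMinimalStinespring U G V π) :
    IsSigmaWeaklyClosable S.domainAlgebra π := by
  intro l _ B hl hB
  have hsandwich (C D : S.domainAlgebra) : (V.adjoint ∘L π (star C)) ∘L B ∘L (π D ∘L V) = 0 := by
    have hCD :
        SigmaWeakTendsto (fun A => ((star C * A * D : S.domainAlgebra) : H →L[ℂ] H)) l 0 := by
      have hlim := hl.sandwich ((star C : S.domainAlgebra) : H →L[ℂ] H) (D : H →L[ℂ] H)
      rwa [ContinuousLinearMap.zero_comp, ContinuousLinearMap.comp_zero] at hlim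
    refine eq_zero_of_isDerivAtZero (S := S) (fun A : S.domainAlgebra => isDerivAtZero_generator
      (mem_domain_of_mem_domainAlgebra (star C * A * D).2)) hCD ?_
    have hlim := ((hB.sandwich (V.adjoint ∘L π (star C)) (π D ∘L V)).add
      (hCD.sandwich G (ContinuousLinearMap.id ℂ H))).add
      (hCD.sandwich (ContinuousLinearMap.id ℂ H) G.adjoint)
    simp only [ContinuousLinearMap.zero_comp, ContinuousLinearMap.comp_zero, add_zero] at hlim
    refine hlim.congr fun A => ?_
    simp only [hπ.generator_eq, ContinuousLinearMap.comp_id, ContinuousLinearMap.id_comp,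
      _root_.map_mul]
    rfl
  refine ContinuousLinearMap.ext_on hπ.minimal ?_
  rintro _ ⟨D, x, -, rfl⟩
  refine eq_of_inner_eq_of_dense_span hπ.minimal ?_
  rintro _ ⟨C, x', -, rfl⟩
  rw [_root_.zero_apply, inner_zero_right, ← ContinuousLinearMap.adjoint_inner_right,
    ← ContinuousLinearMap.star_eq_adjoint, ← StarHomClass.map_star,
    ← ContinuousLinearMap.adjoint_inner_right]
  simpa only [ContinuousLinearMap.comp_apply, _root_.zero_apply, inner_zero_right] using
    congrArg (fun A : H →L[ℂ] H => ⟪x', A x⟫_ℂ) (hsandwich C D)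

end QuantumMarkovSemigroup

theorem proposition5p4_general {H : Type u} [NormedAddCommGroup H] [InnerProductSpace ℂ H]
    [CompleteSpace H] (S : QuantumMarkovSemigroup H)
    (T : H →L[ℂ] H) (hT_pos : T.IsPositive) (hT_dom : T ∈ S.domain)
    (h : H) (hh : ⟪h, T h⟫_ℂ = 1)
    (hTh : InnerProductSpace.rankOne ℂ (T h) (T h) ∈ S.domain)
    (hbound : ∃ C : ℝ, ∀ x ∈ S.rankOneSpace (T h),
      ‖S.generator (InnerProductSpace.rankOne ℂ x (T h)) h‖ ≤ C * ‖x‖)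
    (hdense : Dense (S.rankOneSpace (T h))) :
    (∃ (K : Type u) (_ : NormedAddCommGroup K) (_ : InnerProductSpace ℂ K) (_ : CompleteSpace K)
      (G : H →L[ℂ] H) (V : H →L[ℂ] K) (π : S.domainAlgebra →⋆ₐ[ℂ] (K →L[ℂ] K)),
      (∀ x ∈ S.rankOneSpace (T h),
        G x = S.generator (InnerProductSpace.rankOne ℂ x (T h)) h
          - ((1 / 2 : ℂ) * ⟪h, S.generator T h⟫_ℂ) • x) ∧
      S.IsMinimalStinespring (S.rankOneSpace (T h)) G V π) ∧
    (∀ (K : Type v) [NormedAddCommGroup K] [InnerProductSpace ℂ K] [CompleteSpace K]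
      (G : H →L[ℂ] H) (V : H →L[ℂ] K) (π : S.domainAlgebra →⋆ₐ[ℂ] (K →L[ℂ] K)),
      S.IsMinimalStinespring (S.rankOneSpace (T h)) G V π →
        IsSigmaWeaklyClosable S.domainAlgebra π) := by
  refine ⟨?_, fun K _ _ _ G V π hπ => hπ.isSigmaWeaklyClosable⟩
  obtain ⟨C, hC⟩ := hbound
  obtain ⟨F, hF⟩ := QuantumMarkovSemigroup.exists_apply_eq_generator_rankOne hdense hC
  let G := F - ((1 / 2 : ℂ) * ⟪h, S.generator T h⟫_ℂ) • ContinuousLinearMap.id ℂ H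
  have hG : ∀ x ∈ S.rankOneSpace (T h), G x = S.generator (InnerProductSpace.rankOne ℂ x (T h)) h
      - ((1 / 2 : ℂ) * ⟪h, S.generator T h⟫_ℂ) • x := fun x hx => by
    rw [← hF x hx]
    rfl
  have hyh : ⟪T h, h⟫_ℂ = 1 := by rw [← inner_conj_symm, hh, map_one]
  have hcp := QuantumMarkovSemigroup.isCompletelyPositiveOn_dissipation (G := G) hyh hTh
    (QuantumMarkovSemigroup.re_inner_generator_rankOne_le hT_pos hT_dom hh hTh) hdense
    (by rwa [QuantumMarkovSemigroup.ofReal_re_inner_generator hT_pos.isSelfAdjoint hT_dom])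
  obtain ⟨K, i₁, i₂, i₃, V, π, hπ⟩ := QuantumMarkovSemigroup.exists_isMinimalStinespring hdense hcp
  exact ⟨K, i₁, i₂, i₃, G, V, π, hG, hπ⟩

theorem proposition5p4 {H : Type u} [NormedAddCommGroup H] [InnerProductSpace ℂ H]
    [CompleteSpace H] (S : QuantumMarkovSemigroup H)
    (T : H →L[ℂ] H) (hT_pos : T.IsPositive) (hT_fin : FiniteDimensional ℂ T.range)
    (hT_ne : T ≠ 0) (hT_dom : T ∈ S.domain)
    (h : H) (hh : IsAssociateVector T h)
    (hTh : InnerProductSpace.rankOne ℂ (T h) (T h) ∈ S.domain)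
    (hbound : ∃ C : ℝ, 0 < C ∧ ∀ x ∈ S.rankOneSpace (T h),
      ‖S.generator (InnerProductSpace.rankOne ℂ x (T h)) h‖ ≤ C * ‖x‖)
    (hdense : Dense (S.rankOneSpace (T h))) :
    (∃ (K : Type u) (_ : NormedAddCommGroup K) (_ : InnerProductSpace ℂ K) (_ : CompleteSpace K)
      (G : H →L[ℂ] H) (V : H →L[ℂ] K) (π : S.domainAlgebra →⋆ₐ[ℂ] (K →L[ℂ] K)),
      (∀ x ∈ S.rankOneSpace (T h),
        G x = S.generator (InnerProductSpace.rankOne ℂ x (T h)) h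
          - ((1 / 2 : ℂ) * ⟪h, S.generator T h⟫_ℂ) • x) ∧
      S.IsMinimalStinespring (S.rankOneSpace (T h)) G V π) ∧
    (∀ (K : Type v) [NormedAddCommGroup K] [InnerProductSpace ℂ K] [CompleteSpace K]
      (G : H →L[ℂ] H) (V : H →L[ℂ] K) (π : S.domainAlgebra →⋆ₐ[ℂ] (K →L[ℂ] K)),
      S.IsMinimalStinespring (S.rankOneSpace (T h)) G V π →
        IsSigmaWeaklyClosable S.domainAlgebra π) := by
  obtain ⟨C, -, hC⟩ := hbound
  exact proposition5p4_general S T hT_pos hT_dom h (hh.inner_map_self hT_ne) hTh ⟨C, hC⟩ hdense
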